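/- Let $n\ge 1$, $G=\mathrm{Isom}^+(\mathbb H^{n+1})\cong \mathrm{SO}^+(n+1,1)$ with Lie algebra $\mathfrak g$, let $O\in\mathbb H^{n+1}$ be a base point with stabilizer $K<G$, and let $\Gamma<G$ be a torsion-free discrete subgroup. Let $\xi\in\partial_\infty\mathbb H^{n+1}$ be a full rank parabolic fixed point of $\Gamma$, i.e. $\xi$ is fixed by a parabolic element of $\Gamma$ and $\Gamma_\xi=\Gamma\cap P_\xi$, $P_\xi=\mathrm{Stab}_G(\xi)$, acts cocompactly on the horosphere $\mathcal H_\xi(1)$ centred at $\xi$ through $O$. Let $G=N_\xi A_\xi K$ be the Iwasawa decomposition, where $N_\xi\cong\mathbb R^n$ is the unipotent radical of $P_\xi$ and $A_\xi$ consists of the translations along the geodesic through $O$ with end point $\xi$. Let $\mathfrak g=\mathfrak g_{-2}\oplus\mathfrak g_0\oplus\mathfrak g_2$ be the decomposition under $\mathrm{Ad}(A_\xi)$, with $\mathfrak g_2=\mathfrak n_\xi=\mathrm{Lie}(N_\xi)$, and let $t_\xi:A_\xi\to\mathbb R_{>0}$ be the character such that $\mathrm{Ad}(a)=t_\xi(a)^{\ell}$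 on $\mathfrak g_\ell$. Let $u_1,\dots,u_n$ be the basis of $\mathfrak n_\xi$ whose elements exponentiate to the unit translations of $\mathcal H_\xi(1)\cong\mathbb R^n$ along an orthonormal frame, and let $u_i^*\in\mathfrak g^*$ be the dual covectors, extended by $0$ on $\mathfrak a_\xi\oplus\mathfrak k$ along $\mathfrak g=\mathfrak k\oplus\mathfrak a_\xi\oplus\mathfrak n_\xi$. Let either $V=\mathbb R$ with $\rho$ the trivial representation of $G$ and $v_\xi=1$, or $V=\mathfrak g$ with $\rho=\mathrm{Ad}$ and $v_\xi\in\mathfrak g_{-2}$. For $s\in\mathbb R$ define $\phi_{\xi,s}:G\to\mathrm{Hom}(\Lambda^n\mathfrak g,V)$ by $$\phi_{\xi,s}(nak)=t_\xi(a)^s\,\bigl(\mathrm{Ad}^*(k^{-1})\otimes\rho(k^{-1})\bigr)\bigl((u_1^*\wedge\dots\wedge u_n^*)\otimes v_\xi\bigr),\qquad n\in N_\xi,\ a\in A_\xi,\ k\in K .$$ In the case $V=\mathfrak g$ assume that $v_\xi$ is such that $\phi_{\xi,s}$ is left $\Gamma_\xi$-invariant; in the case $V=\mathbb R$ the function $\phi_{\xi,s}$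 is always left $\Gamma_\xi$-invariant (this is part of the claim). If the Poincaré series $$P_{s/2}(O)=\sum_{\gamma\in\Gamma}e^{-\frac s2 d(O,\gamma O)}$$ converges, then for every $g\in G$ the Eisenstein series $$E(\phi_\xi,g,s)=\sum_{\gamma\in\Gamma_\xi\backslash\Gamma}\phi_{\xi,s}(\gamma g)$$ converges absolutely. -/

import Mathlib

noncomputable section

open Matrix

namespace HypEisenstein

/-! ### Minkowski space and the hyperboloid model -/

/-- Index set of the coordinates of `ℝ^{n+1,1}`: space coordinates `inl i`, one time coordinate
`inr ()`. -/
abbrev Idx (n : ℕ) : Type := Fin (n + 1) ⊕ Unit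

/-- Minkowski space `ℝ^{n+1,1}`. -/
abbrev Mink (n : ℕ) : Type := Idx n → ℝ

/-- The Lorentz form `x_0 y_0 + ... + x_n y_n - (time) (time)`. -/
def lor {n : ℕ} (x y : Mink n) : ℝ :=
  (∑ i : Fin (n + 1), x (Sum.inl i) * y (Sum.inl i)) - x (Sum.inr ()) * y (Sum.inr ())

/-- Hyperbolic space `ℍ^{n+1}`: the upper sheet of the hyperboloid. -/
def hyp (n : ℕ) : Set (Mink n) := {x | lor x x = -1 ∧ 0 < x (Sum.inr ())}

/-- The hyperbolic distance (curvature `-1`): `cosh d(x, y) = -⟨x, y⟩`. -/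
def hypDist {n : ℕ} (x y : Mink n) : ℝ := Real.arcosh (-lor x y)

/-- The base point `O`. -/
def basePt (n : ℕ) : Mink n := Sum.elim (fun _ => 0) (fun _ => 1)

/-- Points of `∂_∞ ℍ^{n+1}`: future light-like rays, represented by their unique vector with time
coordinate `1`. -/
structure Bdry (n : ℕ) where
  vec : Mink n
  null : lor vec vec = 0
  time : vec (Sum.inr ()) = 1

/-! ### Bilinear algebra of the Lorentz form -/

theorem lor_comm {n : ℕ} (x y : Mink n) : lor x y = lor y x := by
  simp only [lor, mul_comm]

theorem lor_add_left {n : ℕ} (x y z : Mink n) : lor (x + y) z = lor x z + lor y z := by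
  simp only [lor, Pi.add_apply, add_mul, Finset.sum_add_distrib]; ring

theorem lor_smul_left {n : ℕ} (c : ℝ) (x z : Mink n) : lor (c • x) z = c * lor x z := by
  simp only [lor, Pi.smul_apply, smul_eq_mul, mul_sub, Finset.mul_sum, mul_assoc]

theorem lor_add_right {n : ℕ} (x y z : Mink n) : lor x (y + z) = lor x y + lor x z := by
  rw [lor_comm, lor_add_left, lor_comm y, lor_comm z]

theorem lor_smul_right {n : ℕ} (c : ℝ) (x z : Mink n) : lor x (c • z) = c * lor x z := by
  rw [lor_comm, lor_smul_left, lor_comm]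

theorem lor_sub_left {n : ℕ} (x y z : Mink n) : lor (x - y) z = lor x z - lor y z := by
  rw [sub_eq_add_neg, ← neg_one_smul ℝ y, lor_add_left, lor_smul_left]; ring

theorem lor_sub_right {n : ℕ} (x y z : Mink n) : lor x (y - z) = lor x y - lor x z := by
  rw [lor_comm, lor_sub_left, lor_comm y, lor_comm z]

theorem lor_base_right {n : ℕ} (x : Mink n) : lor x (basePt n) = -x (Sum.inr ()) := by
  simp [lor, basePt]

theorem lor_base_left {n : ℕ} (x : Mink n) : lor (basePt n) x = -x (Sum.inr ()) := by
  simp [lor, basePt]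

theorem lor_base_base (n : ℕ) : lor (basePt n) (basePt n) = -1 := by
  simp [lor, basePt]

theorem basePt_mem (n : ℕ) : basePt n ∈ hyp n := ⟨lor_base_base n, by simp [basePt]⟩

theorem lor_eq_dot {n : ℕ} (x y : Mink n) :
    lor x y = x ⬝ᵥ (LieAlgebra.Orthogonal.indefiniteDiagonal (Fin (n + 1)) Unit ℝ *ᵥ y) := by
  simp [lor, LieAlgebra.Orthogonal.indefiniteDiagonal, dotProduct, Matrix.mulVec_diagonal,
    sub_eq_add_neg]

/-! ### The group `SO⁺(n+1,1) = Isom⁺(ℍ^{n+1})` and its Lie algebra -/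

/-- The matrix of an element of `SL`. -/
def matSL {n : ℕ} (g : SpecialLinearGroup (Idx n) ℝ) : Matrix (Idx n) (Idx n) ℝ := g

theorem matSL_mul {n : ℕ} (g h : SpecialLinearGroup (Idx n) ℝ) :
    matSL (g * h) = matSL g * matSL h :=
  Matrix.SpecialLinearGroup.coe_mul g h

theorem matSL_one {n : ℕ} : matSL (1 : SpecialLinearGroup (Idx n) ℝ) = 1 :=
  Matrix.SpecialLinearGroup.coe_one

/-- `SO⁺(n+1,1)`: matrices of determinant one which preserve the Lorentz form and the upper sheet
of the hyperboloid. -/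
def SOp (n : ℕ) : Subgroup (SpecialLinearGroup (Idx n) ℝ) where
  carrier := {g | (∀ x y, lor (matSL g *ᵥ x) (matSL g *ᵥ y) = lor x y) ∧
    ∀ x, matSL g *ᵥ x ∈ hyp n ↔ x ∈ hyp n}
  one_mem' := by simp [matSL_one]
  mul_mem' := by
    rintro a b ⟨ha, ha'⟩ ⟨hb, hb'⟩
    refine ⟨fun x y => ?_, fun x => ?_⟩
    · rw [matSL_mul, ← mulVec_mulVec, ← mulVec_mulVec, ha, hb]
    · rw [matSL_mul, ← mulVec_mulVec, ha', hb']
  inv_mem' := by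
    rintro a ⟨ha, ha'⟩
    have key : ∀ x, matSL a *ᵥ (matSL a⁻¹ *ᵥ x) = x := fun x => by
      rw [mulVec_mulVec, ← matSL_mul, mul_inv_cancel, matSL_one, one_mulVec]
    refine ⟨fun x y => ?_, fun x => ?_⟩
    · rw [← ha, key, key]
    · rw [← ha', key]

/-- The matrix of an element of `SO⁺(n+1,1)`. -/
def mat {n : ℕ} (g : SOp n) : Matrix (Idx n) (Idx n) ℝ := matSL g.1

theorem mat_one {n : ℕ} : mat (1 : SOp n) = 1 := matSL_one

theorem mat_mul {n : ℕ} (g h : SOp n) : mat (g * h) = mat g * mat h := matSL_mul g.1 h.1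

theorem mat_mul_inv {n : ℕ} (g : SOp n) : mat g * mat g⁻¹ = 1 := by
  rw [← mat_mul, mul_inv_cancel, mat_one]

theorem mat_inv_mul {n : ℕ} (g : SOp n) : mat g⁻¹ * mat g = 1 := by
  rw [← mat_mul, inv_mul_cancel, mat_one]

theorem lor_mat {n : ℕ} (g : SOp n) (x y : Mink n) : lor (mat g *ᵥ x) (mat g *ᵥ y) = lor x y :=
  g.2.1 x y

theorem mat_mem_hyp {n : ℕ} (g : SOp n) (x : Mink n) : mat g *ᵥ x ∈ hyp n ↔ x ∈ hyp n :=
  g.2.2 x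

/-- The Lie algebra `𝔤 = 𝔰𝔬(n+1,1)`. -/
abbrev LieG (n : ℕ) := LieAlgebra.Orthogonal.so' (Fin (n + 1)) Unit ℝ

theorem mem_LieG_iff {n : ℕ} (X : Matrix (Idx n) (Idx n) ℝ) :
    X ∈ LieG n ↔ ∀ x y, lor (X *ᵥ x) y = -lor x (X *ᵥ y) := by
  change X ∈ skewAdjointMatricesSubmodule _ ↔ _
  rw [mem_skewAdjointMatricesSubmodule]
  simp only [Matrix.IsSkewAdjoint, Matrix.IsAdjointPair]
  have h1 : ∀ x y : Mink n, lor (X *ᵥ x) y =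
      x ⬝ᵥ ((Xᵀ * LieAlgebra.Orthogonal.indefiniteDiagonal (Fin (n + 1)) Unit ℝ) *ᵥ y) := by
    intro x y
    rw [lor_eq_dot, ← mulVec_mulVec, dotProduct_mulVec x, vecMul_transpose]
  have h2 : ∀ x y : Mink n, -lor x (X *ᵥ y) =
      x ⬝ᵥ ((LieAlgebra.Orthogonal.indefiniteDiagonal (Fin (n + 1)) Unit ℝ * -X) *ᵥ y) := by
    intro x y
    rw [lor_eq_dot, ← mulVec_mulVec, neg_mulVec, mulVec_neg, dotProduct_neg]
  constructor
  · intro h x y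
    rw [h1, h2, h]
  · intro h
    refine Matrix.ext_iff_mulVec.2 fun y => ?_
    refine dotProduct_eq _ _ fun x => ?_
    rw [dotProduct_comm, ← h1, h, h2, dotProduct_comm]

theorem conj_mem_LieG {n : ℕ} (g : SOp n) {X : Matrix (Idx n) (Idx n) ℝ} (hX : X ∈ LieG n) :
    mat g * X * mat g⁻¹ ∈ LieG n := by
  rw [mem_LieG_iff] at hX ⊢
  have key : ∀ x, mat g *ᵥ (mat g⁻¹ *ᵥ x) = x := fun x => by
    rw [mulVec_mulVec, mat_mul_inv, one_mulVec]
  intro x y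
  simp only [← mulVec_mulVec]
  conv_lhs => rw [← key y]
  conv_rhs => rw [← key x]
  rw [lor_mat, lor_mat, hX]

/-- The adjoint representation of `G` on `𝔤`, `Ad(g) X = g X g⁻¹`. -/
def adRep (n : ℕ) : Representation ℝ (SOp n) (LieG n) where
  toFun g :=
    { toFun := fun X => ⟨mat g * X.1 * mat g⁻¹, conj_mem_LieG g X.2⟩
      map_add' := fun X Y => Subtype.ext (by simp [mul_add, add_mul])
      map_smul' := fun c X => Subtype.ext (by simp) }
  map_one' := by
    refine LinearMap.ext fun X => Subtype.ext ?_
    simp [mat_one]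
  map_mul' g h := by
    refine LinearMap.ext fun X => Subtype.ext ?_
    simp [mat_mul, mul_assoc]

/-! ### The subgroups attached to a boundary point -/

/-- The matrix of `a ∧ b ∈ 𝔤`, that is, of `x ↦ ⟨a, x⟩ b - ⟨b, x⟩ a`. -/
def wedgeMat {n : ℕ} (a b : Mink n) : Matrix (Idx n) (Idx n) ℝ :=
  LinearMap.toMatrix'
    { toFun := fun x => lor a x • b - lor b x • a
      map_add' := fun x y => by simp only [lor_add_right, add_smul]; abel
      map_smul' := fun c x => by
        simp only [lor_smul_right, mul_smul, smul_sub, RingHom.id_apply] }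

theorem wedgeMat_mulVec {n : ℕ} (a b x : Mink n) :
    wedgeMat a b *ᵥ x = lor a x • b - lor b x • a := by
  rw [wedgeMat, LinearMap.toMatrix'_mulVec]; rfl

theorem wedgeMat_mem {n : ℕ} (a b : Mink n) : wedgeMat a b ∈ LieG n := by
  rw [mem_LieG_iff]
  intro x y
  simp only [wedgeMat_mulVec, lor_sub_left, lor_sub_right, lor_smul_left, lor_smul_right]
  rw [lor_comm x a, lor_comm x b]; ring

/-- The element `a ∧ b` of `𝔤`. -/
def wedge {n : ℕ} (a b : Mink n) : LieG n := ⟨wedgeMat a b, wedgeMat_mem a b⟩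

/-- `ξ ∧ O` generates the translations along the geodesic from `O` to `ξ`, with unit speed towards
`ξ`; `T_ξ ∈ 𝔞_ξ` is twice this element, so that `[T_ξ, u] = 2 u` for `u ∈ 𝔫_ξ`. -/
def genT {n : ℕ} (ξ : Bdry n) : LieG n := (2 : ℝ) • wedge ξ.vec (basePt n)

/-- The restricted root space `𝔤_ℓ = {X | [T_ξ, X] = ℓ X}`, `ℓ ∈ {-2, 0, 2}`. -/
def rootSp {n : ℕ} (ξ : Bdry n) (l : ℝ) : Submodule ℝ (LieG n) :=
  Module.End.eigenspace (LieAlgebra.ad ℝ (LieG n) (genT ξ)) l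

/-- `K`: the stabilizer of `O`. -/
def stabO (n : ℕ) : Subgroup (SOp n) where
  carrier := {g | mat g *ᵥ basePt n = basePt n}
  one_mem' := by simp [mat_one]
  mul_mem' := by
    intro a b ha hb
    change mat _ *ᵥ _ = _ at ha hb
    change mat _ *ᵥ _ = _
    rw [mat_mul, ← mulVec_mulVec, hb, ha]
  inv_mem' := by
    intro a ha
    change mat _ *ᵥ _ = _ at ha
    change mat _ *ᵥ _ = _
    conv_lhs => rw [← ha]
    rw [mulVec_mulVec, mat_inv_mul, one_mulVec]

/-- `P_ξ`: the stabilizer of the boundary point (light-like ray) `ξ`. -/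
def parab {n : ℕ} (ξ : Bdry n) : Subgroup (SOp n) where
  carrier := {g | ∃ c : ℝ, 0 < c ∧ mat g *ᵥ ξ.vec = c • ξ.vec}
  one_mem' := ⟨1, one_pos, by simp [mat_one]⟩
  mul_mem' := by
    rintro a b ⟨c, hc, ha⟩ ⟨d, hd, hb⟩
    refine ⟨d * c, mul_pos hd hc, ?_⟩
    rw [mat_mul, ← mulVec_mulVec, hb, mulVec_smul, ha, smul_smul]
  inv_mem' := by
    rintro a ⟨c, hc, ha⟩
    refine ⟨c⁻¹, inv_pos.2 hc, ?_⟩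
    have h : mat a⁻¹ *ᵥ (mat a *ᵥ ξ.vec) = ξ.vec := by
      rw [mulVec_mulVec, mat_inv_mul, one_mulVec]
    rw [ha, mulVec_smul] at h
    conv_rhs => rw [← h]
    rw [smul_smul, inv_mul_cancel₀ hc.ne', one_smul]

/-- `N_ξ`: the unipotent elements `exp X = 1 + X + X²/2`, `X ∈ 𝔫_ξ = 𝔤_2` (note that `X³ = 0`). -/
def unip {n : ℕ} (ξ : Bdry n) : Set (SOp n) :=
  {g | ∃ X ∈ rootSp ξ 2, mat g = 1 + X.1 + (1 / 2 : ℝ) • (X.1 * X.1)}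

/-- `IsTransl ξ t a`: `a ∈ A_ξ` and `t_ξ(a) = t`. Here `A_ξ` is the group of translations along
the geodesic with end points `ξ` and `ξ⁻ = 2 O - ξ`, which passes through `O`; the element `a` with
character value `t > 0` multiplies `ξ` by `t²`, `ξ⁻` by `t⁻²` and fixes the orthogonal complement.
(Then `Ad(a)` is multiplication by `t^ℓ` on `𝔤_ℓ`, and `a = exp (log t • T_ξ)`.) -/
def IsTransl {n : ℕ} (ξ : Bdry n) (t : ℝ) (a : SOp n) : Prop :=
  0 < t ∧ mat a *ᵥ ξ.vec = t ^ 2 • ξ.vec ∧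
    mat a *ᵥ ((2 : ℝ) • basePt n - ξ.vec) = (t ^ 2)⁻¹ • ((2 : ℝ) • basePt n - ξ.vec) ∧
    ∀ x, lor (basePt n) x = 0 → lor ξ.vec x = 0 → mat a *ᵥ x = x

/-- The horosphere `ℋ_ξ(1)` centred at `ξ` and passing through `O`. -/
def horosphere {n : ℕ} (ξ : Bdry n) : Set (Mink n) := {x | x ∈ hyp n ∧ lor x ξ.vec = -1}

/-! ### Iwasawa decomposition -/

theorem lor_base_vec {n : ℕ} (ξ : Bdry n) : lor (basePt n) ξ.vec = -1 := by
  rw [lor_base_left, ξ.time]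

theorem lor_neg_of_hyp {n : ℕ} (ξ : Bdry n) {x : Mink n} (hx : lor x x = -1) :
    0 < x (Sum.inr ()) ↔ lor x ξ.vec < 0 := by
  have h0 := ξ.null
  have ht := ξ.time
  have hcs := Finset.sum_mul_sq_le_sq_mul_sq (Finset.univ : Finset (Fin (n + 1)))
    (fun i => x (Sum.inl i)) (fun i => ξ.vec (Sum.inl i))
  simp only [lor, ht, ← pow_two] at *
  set S := ∑ i, x (Sum.inl i) * ξ.vec (Sum.inl i)
  have h1 : ∑ i, ξ.vec (Sum.inl i) ^ 2 = 1 := by linarith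
  rw [h1] at hcs
  have h2 : S ^ 2 < x (Sum.inr ()) ^ 2 := by linarith
  constructor
  · intro h
    have := (abs_lt_of_sq_lt_sq h2 h.le)
    rw [abs_lt] at this
    linarith [this.2]
  · intro h
    by_contra hc
    have h4 : S ^ 2 < (-x (Sum.inr ())) ^ 2 := by rwa [neg_sq]
    have := (abs_lt_of_sq_lt_sq h4 (by linarith))
    rw [abs_lt] at this
    linarith [this.1]

/-- A matrix which is the square of a matrix preserving the Lorentz form, and which multiplies a
future light-like vector by a positive number, lies in `SO⁺(n+1,1)`. -/
theorem exists_mat_eq {n : ℕ} (ξ : Bdry n) (M S : Matrix (Idx n) (Idx n) ℝ) (hSM : S * S = M)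
    (hS : ∀ x y, lor (S *ᵥ x) (S *ᵥ y) = lor x y) (c : ℝ) (hc : 0 < c)
    (hM : M *ᵥ ξ.vec = c • ξ.vec) : ∃ g : SOp n, mat g = M := by
  have hlor : ∀ x y, lor (M *ᵥ x) (M *ᵥ y) = lor x y := fun x y => by
    rw [← hSM, ← mulVec_mulVec, ← mulVec_mulVec, hS, hS]
  have hdet : M.det = 1 := by
    have hJ : Sᵀ * LieAlgebra.Orthogonal.indefiniteDiagonal (Fin (n + 1)) Unit ℝ * S =
        LieAlgebra.Orthogonal.indefiniteDiagonal (Fin (n + 1)) Unit ℝ := by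
      refine Matrix.ext_iff_mulVec.2 fun y => ?_
      refine dotProduct_eq _ _ fun x => ?_
      rw [dotProduct_comm, dotProduct_comm _ x, ← lor_eq_dot, ← hS, lor_eq_dot, ← mulVec_mulVec,
        ← mulVec_mulVec, dotProduct_mulVec x, vecMul_transpose]
    have h1 := congrArg Matrix.det hJ
    rw [det_mul, det_mul, det_transpose] at h1
    have h2 : (LieAlgebra.Orthogonal.indefiniteDiagonal (Fin (n + 1)) Unit ℝ).det ≠ 0 := by
      simp [LieAlgebra.Orthogonal.indefiniteDiagonal, det_diagonal]
    rw [← hSM, det_mul]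
    exact mul_right_cancel₀ h2 (by linarith)
  refine ⟨⟨⟨M, hdet⟩, hlor, fun x => ?_⟩, rfl⟩
  change M *ᵥ x ∈ hyp n ↔ _
  simp only [hyp, Set.mem_ofPred_eq, hlor]
  refine and_congr_right fun hx => ?_
  rw [lor_neg_of_hyp ξ hx, lor_neg_of_hyp ξ ((hlor x x).trans hx)]
  have h3 : lor x ξ.vec = c * lor (M *ᵥ x) ξ.vec := by
    rw [← hlor, hM, lor_smul_right]
  rw [h3]
  constructor
  · intro h; exact mul_neg_of_pos_of_neg hc h
  · intro h; by_contra h'; nlinarith [mul_nonneg hc.le (not_lt.1 h')]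

theorem lor_quad {n : ℕ} {X : Matrix (Idx n) (Idx n) ℝ} (hX : X ∈ LieG n) (b c : ℝ)
    (h : (1 - b • X + c • (X * X)) * (1 + b • X + c • (X * X)) = 1) (x y : Mink n) :
    lor ((1 + b • X + c • (X * X)) *ᵥ x) ((1 + b • X + c • (X * X)) *ᵥ y) = lor x y := by
  rw [mem_LieG_iff] at hX
  have h1 : ∀ z, lor ((1 + b • X + c • (X * X)) *ᵥ x) z =
      lor x ((1 - b • X + c • (X * X)) *ᵥ z) := fun z => by
    simp only [add_mulVec, sub_mulVec, one_mulVec, smul_mulVec, ← mulVec_mulVec, lor_add_left,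
      lor_add_right, lor_sub_right, lor_smul_left, lor_smul_right, hX]
    ring
  rw [h1, mulVec_mulVec, h, one_mulVec]

theorem exists_unip {n : ℕ} (ξ : Bdry n) (u : Mink n) (h0 : lor (basePt n) u = 0)
    (h1 : lor ξ.vec u = 0) : ∃ g ∈ unip ξ,
      ∀ x, mat g *ᵥ x = x + (lor u x • ξ.vec - lor ξ.vec x • u)
        - (lor u u / 2 * lor ξ.vec x) • ξ.vec := by
  set X := wedgeMat u ξ.vec with hXdef
  have hn := ξ.null
  have hO := lor_base_vec ξ
  have hX3 : X * X * X = 0 := by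
    refine Matrix.ext_iff_mulVec.2 fun y => ?_
    simp only [hXdef, ← mulVec_mulVec, wedgeMat_mulVec, lor_sub_right, lor_smul_right, hn, h1,
      lor_comm u ξ.vec]
    simp
  have hmem : wedge u ξ.vec ∈ rootSp ξ 2 := by
    rw [rootSp, Module.End.mem_eigenspace_iff]
    refine Subtype.ext ?_
    change ((2 : ℝ) • wedgeMat ξ.vec (basePt n)) * wedgeMat u ξ.vec -
      wedgeMat u ξ.vec * ((2 : ℝ) • wedgeMat ξ.vec (basePt n)) = (2 : ℝ) • wedgeMat u ξ.vec
    refine Matrix.ext_iff_mulVec.2 fun y => ?_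
    simp only [sub_mulVec, ← mulVec_mulVec, smul_mulVec, mulVec_smul, wedgeMat_mulVec,
      lor_sub_right, lor_smul_right, hn, h1, h0, hO, lor_comm u ξ.vec, lor_comm u (basePt n),
      lor_comm ξ.vec (basePt n)]
    module
  have hS : ∀ x y, lor ((1 + (1 / 2 : ℝ) • X + (1 / 8 : ℝ) • (X * X)) *ᵥ x)
      ((1 + (1 / 2 : ℝ) • X + (1 / 8 : ℝ) • (X * X)) *ᵥ y) = lor x y := by
    refine lor_quad (X := X) (wedgeMat_mem _ _) _ _ ?_
    have h4 : X * (X * X) = 0 := by rw [← mul_assoc, hX3]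
    simp only [mul_add, add_mul, sub_mul, mul_one, one_mul, smul_mul_assoc, mul_smul_comm,
      hX3, h4, mul_assoc]
    simp only [mul_zero, smul_zero]
    module
  have hSM : (1 + (1 / 2 : ℝ) • X + (1 / 8 : ℝ) • (X * X)) *
      (1 + (1 / 2 : ℝ) • X + (1 / 8 : ℝ) • (X * X)) = 1 + X + (1 / 2 : ℝ) • (X * X) := by
    have h4 : X * (X * X) = 0 := by rw [← mul_assoc, hX3]
    simp only [mul_add, add_mul, mul_one, one_mul, smul_mul_assoc, mul_smul_comm,
      h4, mul_assoc]
    simp only [mul_zero, smul_zero]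
    module
  have hact : ∀ x, (1 + X + (1 / 2 : ℝ) • (X * X)) *ᵥ x =
      x + (lor u x • ξ.vec - lor ξ.vec x • u) - (lor u u / 2 * lor ξ.vec x) • ξ.vec := by
    intro x
    simp only [hXdef, add_mulVec, one_mulVec, smul_mulVec, ← mulVec_mulVec, wedgeMat_mulVec,
      lor_sub_right, lor_smul_right, hn, h1, lor_comm u ξ.vec]
    module
  obtain ⟨g, hg⟩ := exists_mat_eq ξ _ _ hSM hS 1 one_pos (by
    rw [hact]; simp [hn, lor_comm u ξ.vec, h1])
  exact ⟨g, ⟨wedge u ξ.vec, hmem, hg⟩, fun x => by rw [hg, hact]⟩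

theorem exists_transl {n : ℕ} (ξ : Bdry n) (t : ℝ) (ht : 0 < t) : ∃ a, IsTransl ξ t a := by
  set X := wedgeMat ξ.vec (basePt n) with hXdef
  have hn := ξ.null
  have hO := lor_base_vec ξ
  have hOO := lor_base_base n
  have hX3 : X * (X * X) = X := by
    refine Matrix.ext_iff_mulVec.2 fun y => ?_
    simp only [hXdef, ← mulVec_mulVec, wedgeMat_mulVec, lor_sub_right, lor_smul_right, hn, hO, hOO,
      lor_comm ξ.vec (basePt n)]
    module
  set b := (t - t⁻¹) / 2 with hb
  set c := (t + t⁻¹) / 2 - 1 with hc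
  have htt : t * t⁻¹ = 1 := mul_inv_cancel₀ ht.ne'
  have hbc : b ^ 2 = c ^ 2 + 2 * c := by
    rw [hb, hc]; linear_combination (-1) * htt
  have hS : ∀ x y, lor ((1 + b • X + c • (X * X)) *ᵥ x)
      ((1 + b • X + c • (X * X)) *ᵥ y) = lor x y := by
    refine lor_quad (X := X) (wedgeMat_mem _ _) _ _ ?_
    simp only [mul_add, add_mul, sub_mul, mul_one, one_mul, smul_mul_assoc, mul_smul_comm,
      hX3, mul_assoc]
    have : (c ^ 2 + 2 * c - b ^ 2) • (X * X) = 0 := by rw [hbc]; simp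
    rw [← sub_eq_zero, ← this]
    module
  have hact : ∀ x, (1 + b • X + c • (X * X)) *ᵥ x = x +
      b • (lor ξ.vec x • basePt n - lor (basePt n) x • ξ.vec) +
      c • (lor ξ.vec x • ξ.vec - lor ξ.vec x • basePt n - lor (basePt n) x • ξ.vec) := by
    intro x
    simp only [hXdef, add_mulVec, one_mulVec, smul_mulVec, ← mulVec_mulVec, wedgeMat_mulVec,
      lor_sub_right, lor_smul_right, hn, hO, hOO, lor_comm ξ.vec (basePt n)]
    module
  have hξ : (1 + b • X + c • (X * X)) *ᵥ ξ.vec = t • ξ.vec := by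
    rw [hact, hn, hO, hb, hc]; module
  have hη : (1 + b • X + c • (X * X)) *ᵥ ((2 : ℝ) • basePt n - ξ.vec) =
      t⁻¹ • ((2 : ℝ) • basePt n - ξ.vec) := by
    rw [hact]
    simp only [lor_sub_right, lor_smul_right, hn, hO, hOO, lor_comm ξ.vec (basePt n)]
    rw [hb, hc]; module
  obtain ⟨a, ha⟩ := exists_mat_eq ξ _ _ rfl hS (t ^ 2) (by positivity) (by
    rw [← mulVec_mulVec, hξ, mulVec_smul, hξ, smul_smul, pow_two])
  refine ⟨a, ht, ?_, ?_, fun x h0 h1 => ?_⟩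
  · rw [ha, ← mulVec_mulVec, hξ, mulVec_smul, hξ, smul_smul, pow_two]
  · rw [ha, ← mulVec_mulVec, hη, mulVec_smul, hη, smul_smul, pow_two, mul_inv]
  · rw [ha, ← mulVec_mulVec, hact x, h0, h1]
    simp [hact, h0, h1]

/-- The Iwasawa decomposition `G = N_ξ A_ξ K`. -/
theorem iwasawa {n : ℕ} (ξ : Bdry n) (g : SOp n) : ∃ (t : ℝ) (u a k : SOp n),
    u ∈ unip ξ ∧ IsTransl ξ t a ∧ k ∈ stabO n ∧ g = u * a * k := by
  have hn := ξ.null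
  have hO := lor_base_vec ξ
  have hOO := lor_base_base n
  have hy := (mat_mem_hyp g _).2 (basePt_mem n)
  set y := mat g *ᵥ basePt n with hydef
  have hneg := (lor_neg_of_hyp ξ hy.1).1 hy.2
  set q := -lor y ξ.vec with hq
  have hqpos : 0 < q := by linarith
  have hyξ : lor ξ.vec y = -q := by rw [lor_comm]; linarith
  set p := -lor (basePt n) y with hp
  have hyO : lor (basePt n) y = -p := by linarith
  -- the projection of `y` to the orthogonal complement of `O` and `ξ`
  set v := y - q • basePt n - (p - q) • ξ.vec with hv
  have hv0 : lor (basePt n) v = 0 := by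
    simp only [hv, lor_sub_right, lor_smul_right, hO, hOO, hyO]; ring
  have hv1 : lor ξ.vec v = 0 := by
    simp only [hv, lor_sub_right, lor_smul_right, hn, hyξ, lor_comm ξ.vec (basePt n), hO]; ring
  have hyv : y = v + q • basePt n + (p - q) • ξ.vec := by rw [hv]; module
  have hvv : lor v v = -1 + 2 * p * q - q ^ 2 := by
    have h := hy.1
    rw [hyv] at h
    simp only [lor_add_right, lor_add_left, lor_smul_left, lor_smul_right, hn, hO, hOO, hv0, hv1,
      lor_comm v ξ.vec, lor_comm v (basePt n), lor_comm ξ.vec (basePt n)] at h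
    linarith
  obtain ⟨u, hu, huact⟩ := exists_unip ξ (q⁻¹ • v) (by rw [lor_smul_right, hv0, mul_zero])
    (by rw [lor_smul_right, hv1, mul_zero])
  have hsq : (Real.sqrt q)⁻¹ ^ 2 = q⁻¹ := by rw [inv_pow, Real.sq_sqrt hqpos.le]
  obtain ⟨a, ha⟩ := exists_transl ξ (Real.sqrt q)⁻¹ (by positivity)
  refine ⟨_, u, a, (u * a)⁻¹ * g, hu, ha, ?_, by group⟩
  have ha1 := ha.2.1
  have ha2 := ha.2.2.1
  rw [hsq] at ha1 ha2
  have haO : mat a *ᵥ basePt n = q • basePt n + ((q⁻¹ - q) / 2) • ξ.vec := by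
    have h : basePt n = (1 / 2 : ℝ) • (((2 : ℝ) • basePt n - ξ.vec) + ξ.vec) := by module
    conv_lhs => rw [h, mulVec_smul, mulVec_add, ha1, ha2, inv_inv]
    module
  have huaO : mat (u * a) *ᵥ basePt n = y := by
    rw [mat_mul, ← mulVec_mulVec, haO, huact]
    simp only [lor_add_right, lor_smul_left, lor_smul_right, hn, hO, hv0, hv1,
      lor_comm v ξ.vec, lor_comm v (basePt n), lor_comm ξ.vec (basePt n), hvv]
    rw [hyv]
    match_scalars
    · field_simp
      ring
    · field_simp
      ring
    · field_simp
      ring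
  change mat ((u * a)⁻¹ * g) *ᵥ basePt n = basePt n
  rw [mat_mul, ← mulVec_mulVec, ← hydef, ← huaO, mulVec_mulVec, mat_inv_mul, one_mulVec]

/-- The `A`-component of `g = n a k`, recorded through its character value `t_ξ(a) > 0`. -/
def iwT {n : ℕ} (ξ : Bdry n) (g : SOp n) : ℝ := (iwasawa ξ g).choose

/-- The `K`-component of `g = n a k ∈ N_ξ A_ξ K`. -/
def iwK {n : ℕ} (ξ : Bdry n) (g : SOp n) : SOp n :=
  (iwasawa ξ g).choose_spec.choose_spec.choose_spec.choose

theorem iwasawa_spec {n : ℕ} (ξ : Bdry n) (g : SOp n) : ∃ u a : SOp n,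
    u ∈ unip ξ ∧ IsTransl ξ (iwT ξ g) a ∧ iwK ξ g ∈ stabO n ∧ g = u * a * iwK ξ g :=
  ⟨_, _, (iwasawa ξ g).choose_spec.choose_spec.choose_spec.choose_spec⟩

/-! ### The form `φ_{ξ,s}` as a function on `G` -/

/-- `e_1, …, e_n` is an orthonormal frame of the tangent space of `ℋ_ξ(1)` at `O`. The element
`u_i = e_i ∧ ξ ∈ 𝔫_ξ` then exponentiates to the unit translation of `ℋ_ξ(1)` in direction `e_i`. -/
def IsFrame {n : ℕ} (ξ : Bdry n) (e : Fin n → Mink n) : Prop :=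
  (∀ i, lor (e i) (basePt n) = 0) ∧ (∀ i, lor (e i) ξ.vec = 0) ∧
    ∀ i j, lor (e i) (e j) = if i = j then 1 else 0

/-- The covector tuple `X ↦ (u_1^*(X), …, u_n^*(X))`, where `u_i^*(X) = ⟨e_i, X O⟩`. These are the
covectors on `𝔤 = 𝔨 ⊕ 𝔞_ξ ⊕ 𝔫_ξ` with `u_i^*(u_j) = δ_{ij}` which vanish on `𝔨` and `𝔞_ξ`. -/
def coframe {n : ℕ} (e : Fin n → Mink n) : LieG n →ₗ[ℝ] (Fin n → ℝ) where
  toFun X i := lor (e i) (X.1 *ᵥ basePt n)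
  map_add' X Y := by
    funext i
    simp [add_mulVec, lor_add_right]
  map_smul' c X := by
    funext i
    simp [smul_mulVec, lor_smul_right]

theorem coframe_wedge {n : ℕ} {ξ : Bdry n} {e : Fin n → Mink n} (he : IsFrame ξ e) (i j : Fin n) :
    coframe e (wedge (e j) ξ.vec) i = if i = j then 1 else 0 := by
  change lor (e i) (wedgeMat (e j) ξ.vec *ᵥ basePt n) = _
  rw [wedgeMat_mulVec, he.1, lor_comm ξ.vec, lor_base_vec, zero_smul, zero_sub, ← neg_smul, neg_neg,
    one_smul, he.2.2]

/-- `Hom(Λ^n 𝔤, V)`. The form values below vanish as soon as one argument is in `𝔨`, so they are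
determined by their restriction to `𝔞_ξ ⊕ 𝔫_ξ`. -/
abbrev FormVal (n : ℕ) (V : Type) [AddCommGroup V] [Module ℝ V] : Type :=
  LieG n [⋀^Fin n]→ₗ[ℝ] V

/-- `(u_1^* ∧ … ∧ u_n^*) ⊗ v`. -/
def initVal {n : ℕ} {V : Type} [AddCommGroup V] [Module ℝ V] (e : Fin n → Mink n) (v : V) :
    FormVal n V :=
  (LinearMap.toSpanSingleton ℝ V v).compAlternatingMap
    ((Matrix.detRowAlternating (R := ℝ) (n := Fin n)).compLinearMap (coframe e))

/-- The action `Ad^*(k) ⊗ ρ(k)` on `Hom(Λ^n 𝔤, V)`: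
`(X_1, …, X_n) ↦ ρ(k) (η (Ad(k⁻¹) X_1, …, Ad(k⁻¹) X_n))`. -/
def coAct {n : ℕ} {V : Type} [AddCommGroup V] [Module ℝ V] (ρ : Representation ℝ (SOp n) V)
    (k : SOp n) (η : FormVal n V) : FormVal n V :=
  (ρ k).compAlternatingMap (η.compLinearMap (adRep n k⁻¹))

/-- The degree `s` extension
`φ_{ξ,s}(n a k) = t_ξ(a)^s (Ad^*(k⁻¹) ⊗ ρ(k⁻¹)) ((u_1^* ∧ … ∧ u_n^*) ⊗ v)`, as a function on `G`. -/
def phi {n : ℕ} {V : Type} [AddCommGroup V] [Module ℝ V] (ρ : Representation ℝ (SOp n) V)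
    (ξ : Bdry n) (e : Fin n → Mink n) (v : V) (s : ℝ) (g : SOp n) : FormVal n V :=
  (iwT ξ g) ^ s • coAct ρ (iwK ξ g)⁻¹ (initVal e v)

/-! ### Discrete groups, cusps, series -/

/-- `Γ` has no nontrivial element of finite order. -/
def TorsionFree {n : ℕ} (Γ : Subgroup (SOp n)) : Prop := ∀ γ ∈ Γ, IsOfFinOrder γ → γ = 1

/-- Parabolic isometries: no fixed point in `ℍ^{n+1}`, exactly one in `∂_∞ ℍ^{n+1}`. -/
def IsParabolic {n : ℕ} (g : SOp n) : Prop :=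
  (∀ x ∈ hyp n, mat g *ᵥ x ≠ x) ∧ ∃! ξ : Bdry n, g ∈ parab ξ

/-- `ξ` is a full rank parabolic fixed point of `Γ`: it is fixed by a parabolic element of `Γ`, and
`Γ_ξ = Γ ∩ P_ξ` moves every point of the `n`-dimensional horosphere `ℋ_ξ(1)` into some fixed compact
subset of it. -/
def IsFullRankParabolicPt {n : ℕ} (Γ : Subgroup (SOp n)) (ξ : Bdry n) : Prop :=
  (∃ γ ∈ Γ, IsParabolic γ ∧ γ ∈ parab ξ) ∧
    ∃ C : Set (Mink n), IsCompact C ∧ C ⊆ horosphere ξ ∧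
      ∀ x ∈ horosphere ξ, ∃ γ ∈ Γ ⊓ parab ξ, mat γ *ᵥ x ∈ C

/-- Convergence of the Poincaré series `P_s(x) = ∑_{γ ∈ Γ} exp (-s d(O, γ x))`. -/
def PoincareConverges {n : ℕ} (Γ : Subgroup (SOp n)) (s : ℝ) (x : Mink n) : Prop :=
  Summable fun γ : Γ => Real.exp (-s * hypDist (basePt n) (mat γ.1 *ᵥ x))

/-- Left invariance of a function on `G` under `Γ_ξ = Γ ∩ P_ξ`. -/
def LeftInv {n : ℕ} {E : Type} (Γ : Subgroup (SOp n)) (ξ : Bdry n) (φ : SOp n → E) : Prop :=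
  ∀ γ ∈ Γ ⊓ parab ξ, ∀ g, φ (γ * g) = φ g

/-- The coset space `Γ_ξ \ Γ`. -/
abbrev CosetSp {n : ℕ} (Γ : Subgroup (SOp n)) (ξ : Bdry n) : Type :=
  Quotient (QuotientGroup.rightRel ((Γ ⊓ parab ξ).subgroupOf Γ))

/-- The term `φ(γ g)` of the Eisenstein series `E(φ, g) = ∑_{γ ∈ Γ_ξ \ Γ} φ(γ g)`. -/
def eisTerm {n : ℕ} {E : Type} (Γ : Subgroup (SOp n)) (ξ : Bdry n) (φ : SOp n → E)
    (hφ : LeftInv Γ ξ φ) (g : SOp n) (c : CosetSp Γ ξ) : E :=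
  Quotient.lift (fun γ : Γ => φ (γ.1 * g)) (fun a b hab => by
    have h := QuotientGroup.rightRel_apply.1 hab
    have h2 : b.1 * a.1⁻¹ ∈ Γ ⊓ parab ξ := Subgroup.mem_subgroupOf.1 h
    have h3 := hφ _ h2 (a.1 * g)
    rw [← mul_assoc, inv_mul_cancel_right] at h3
    exact h3.symm) c

/-- Absolute convergence of a series in a finite-dimensional real vector space: the (semi)norms of
its terms are summable, for every (semi)norm. -/
def AbsConv {ι E : Type} [AddCommGroup E] [Module ℝ E] (f : ι → E) : Prop :=
  ∀ N : Seminorm ℝ E, Summable fun i => N (f i)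

end HypEisenstein

end

/-!
Write `q(g) = -⟨g O, ξ⟩ > 0`. Since `N_ξ` fixes the light-like vector `ξ` and `a ∈ A_ξ` multiplies
it by `t_ξ(a)²`, the Iwasawa component satisfies `t_ξ(g)² = q(g)⁻¹` (`iwT_sq`), so up to a factor
which is bounded because `K` is compact (`exists_seminorm_coAct_le`) the Eisenstein series is
`∑ q(γ g)^(-s/2)` over `Γ_ξ \ Γ`. The Poincaré series is comparable to `∑ (cosh d(O, γ O))^(-s/2)`
over `Γ`. It therefore suffices to find in every coset a representative `γ` with
`cosh d(O, γ O) ≤ C q(γ g)` (`exists_rep_coshDisp_le`).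

The representative is chosen so that `γ g O` lies above a fixed compact subset of the horosphere; in
the half-space model with `ξ = ∞` it is then a point `(y, h)` with `y` bounded and `h = q⁻¹`, whose
distance to `O` is `-log h` up to a constant provided that `h` is bounded from above. That upper
bound is where discreteness enters (`exists_horoball_avoiding_orbit`): a nontrivial `β ∈ Γ` which
fixes the vector `ξ` moves `(y, h)` by a distance of order `h⁻¹`, so orbit points with large `h`
would produce conjugates of `β` in `Γ` moving `O` arbitrarily little, while a torsion-free discrete
group has no nontrivial elements of small displacement (`exists_gap`).

The same bound shows that `Γ_ξ` fixes the vector `ξ` and not just its ray (`fix_vec_of_mem_parab`):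
otherwise powers of an element of `Γ_ξ` would move `O` into every horoball at `ξ`. With this, the
invariance of `φ_{ξ,s}` for `V = ℝ` reduces to the fact that an element of `SO⁺(n+1,1)` fixing `O`
and `ξ` has determinant one on their orthogonal complement (`det_lor_mat`). For `s ≤ 0` the
Poincaré series converges only for finite `Γ`, and the Eisenstein series is a finite sum.
-/

noncomputable section

open Matrix

namespace HypEisenstein

/-! ### Displacement of the base point and discreteness -/

theorem mat_inv_mulVec {n : ℕ} (g : SOp n) (x : Mink n) : mat g⁻¹ *ᵥ (mat g *ᵥ x) = x := by
  rw [mulVec_mulVec, mat_inv_mul, one_mulVec]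

theorem lor_mat_left {n : ℕ} (g : SOp n) (x y : Mink n) :
    lor (mat g *ᵥ x) y = lor x (mat g⁻¹ *ᵥ y) := by
  rw [← lor_mat g⁻¹, mat_inv_mulVec]

theorem lor_mat_right {n : ℕ} (g : SOp n) (x y : Mink n) :
    lor x (mat g *ᵥ y) = lor (mat g⁻¹ *ᵥ x) y := by
  rw [lor_comm, lor_mat_left, lor_comm]

theorem mat_mul_mulVec {n : ℕ} (g h : SOp n) (x : Mink n) :
    mat (g * h) *ᵥ x = mat g *ᵥ (mat h *ᵥ x) := by
  rw [mat_mul, mulVec_mulVec]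

theorem mat_mulVec_basePt {n : ℕ} (g : SOp n) (a : Idx n) :
    (mat g *ᵥ basePt n) a = mat g a (Sum.inr ()) := by
  simp [basePt, mulVec, dotProduct]

/-- `cosh d(O, g O)`, which is the time-time entry of the matrix of `g`. -/
def coshDisp {n : ℕ} (g : SOp n) : ℝ := mat g (Sum.inr ()) (Sum.inr ())

theorem coshDisp_eq {n : ℕ} (g : SOp n) :
    coshDisp g = -lor (basePt n) (mat g *ᵥ basePt n) := by
  rw [lor_base_left, neg_neg, mat_mulVec_basePt, coshDisp]

theorem coshDisp_inv {n : ℕ} (g : SOp n) : coshDisp g⁻¹ = coshDisp g := by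
  rw [coshDisp_eq, coshDisp_eq, ← lor_mat_left, lor_comm]

theorem sum_sq_of_lor_eq {n : ℕ} {x : Mink n} {c : ℝ} (hx : lor x x = c) :
    ∑ i, x (Sum.inl i) ^ 2 = x (Sum.inr ()) ^ 2 + c := by
  simp only [lor, ← pow_two] at hx
  linarith

theorem sum_sq_mat_col {n : ℕ} (g : SOp n) :
    ∑ i, mat g (Sum.inl i) (Sum.inr ()) ^ 2 = coshDisp g ^ 2 - 1 := by
  have h := sum_sq_of_lor_eq ((mat_mem_hyp g _).2 (basePt_mem n)).1
  simpa only [mat_mulVec_basePt, coshDisp, sub_eq_add_neg] using h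

theorem one_le_coshDisp {n : ℕ} (g : SOp n) : 1 ≤ coshDisp g := by
  have h1 := sum_sq_mat_col g
  have h2 : 0 ≤ ∑ i, mat g (Sum.inl i) (Sum.inr ()) ^ 2 :=
    Finset.sum_nonneg fun i _ => sq_nonneg _
  have h3 := ((mat_mem_hyp g _).2 (basePt_mem n)).2
  rw [mat_mulVec_basePt] at h3
  change 0 < coshDisp g at h3
  nlinarith

theorem mem_stabO_iff {n : ℕ} (g : SOp n) : g ∈ stabO n ↔ mat g *ᵥ basePt n = basePt n := Iff.rfl

theorem mem_stabO_of_coshDisp {n : ℕ} {g : SOp n} (h : coshDisp g = 1) : g ∈ stabO n := by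
  have h1 := sum_sq_mat_col g
  rw [h, one_pow, sub_self, Finset.sum_eq_zero_iff_of_nonneg fun i _ => sq_nonneg _] at h1
  rw [mem_stabO_iff]
  funext a
  rw [mat_mulVec_basePt]
  rcases a with i | u
  · simpa [basePt] using h1 i (Finset.mem_univ i)
  · simpa [basePt, coshDisp] using h

theorem coshDisp_of_mem_stabO {n : ℕ} {g : SOp n} (h : g ∈ stabO n) : coshDisp g = 1 := by
  rw [coshDisp_eq, (mem_stabO_iff g).1 h, lor_base_base, neg_neg]

/-- All entries of a Lorentz matrix are dominated by its time-time entry. -/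
theorem abs_mat_le {n : ℕ} (g : SOp n) (a b : Idx n) : |mat g a b| ≤ coshDisp g := by
  have h1 := one_le_coshDisp g
  have hcol : ∀ a, (mat g *ᵥ Pi.single b 1) a = mat g a b := fun a => by simp
  -- the time row of `g` is, up to sign, the orbit point `g⁻¹ O`
  have hrow : ∀ j, mat g (Sum.inr ()) (Sum.inl j) ^ 2 ≤ coshDisp g ^ 2 - 1 := by
    intro j
    have h2 : mat g (Sum.inr ()) (Sum.inl j) = -mat g⁻¹ (Sum.inl j) (Sum.inr ()) := by
      have h3 : lor (mat g⁻¹ *ᵥ basePt n) (Pi.single (Sum.inl j) 1) =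
          mat g⁻¹ (Sum.inl j) (Sum.inr ()) := by
        simp [lor, mat_mulVec_basePt, Pi.single_apply]
      rw [← h3, ← lor_mat_right, lor_base_left]
      simp
    rw [h2, neg_sq, ← coshDisp_inv, ← sum_sq_mat_col]
    exact Finset.single_le_sum (f := fun i => mat g⁻¹ (Sum.inl i) (Sum.inr ()) ^ 2)
      (fun i _ => sq_nonneg _) (Finset.mem_univ j)
  have hspace : ∀ c : ℝ, (∑ i, mat g (Sum.inl i) b ^ 2 ≤ c) →
      ∀ i, mat g (Sum.inl i) b ^ 2 ≤ c := fun c hc i =>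
    (Finset.single_le_sum (f := fun i => mat g (Sum.inl i) b ^ 2)
      (fun i _ => sq_nonneg _) (Finset.mem_univ i)).trans hc
  refine abs_le_of_sq_le_sq ?_ (by linarith)
  rcases b with j | u
  · have h2 : ∑ i, mat g (Sum.inl i) (Sum.inl j) ^ 2 ≤ coshDisp g ^ 2 := by
      have h3 : lor (mat g *ᵥ Pi.single (Sum.inl j) 1) (mat g *ᵥ Pi.single (Sum.inl j) 1) = 1 := by
        rw [lor_mat]; simp [lor, Pi.single_apply]
      have h4 := sum_sq_of_lor_eq h3
      simp only [hcol] at h4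
      linarith [hrow j]
    rcases a with i | u
    · exact hspace _ h2 i
    · linarith [hrow j]
  · rcases a with i | u'
    · exact hspace _ (by rw [sum_sq_mat_col]; linarith) i
    · exact le_rfl

theorem abs_mulVec_le {n : ℕ} {g : SOp n} (hg : g ∈ stabO n) (x : Mink n) (a : Idx n) :
    |(mat g *ᵥ x) a| ≤ ∑ b, |x b| := by
  change |∑ b, mat g a b * x b| ≤ _
  refine (Finset.abs_sum_le_sum_abs _ _).trans (Finset.sum_le_sum fun b _ => ?_)
  rw [abs_mul]
  exact mul_le_of_le_one_left (abs_nonneg _)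
    ((abs_mat_le g a b).trans (coshDisp_of_mem_stabO hg).le)

theorem continuous_lor_mulVec {n : ℕ} (x y : Mink n) :
    Continuous fun g : SpecialLinearGroup (Idx n) ℝ => lor (matSL g *ᵥ x) (matSL g *ᵥ y) := by
  have h : Continuous fun g : SpecialLinearGroup (Idx n) ℝ => matSL g :=
    SpecialLinearGroup.isClosedEmbedding_val.continuous
  unfold lor
  fun_prop

theorem isClosed_SOp (n : ℕ) : IsClosed (SOp n : Set (SpecialLinearGroup (Idx n) ℝ)) := by
  have hc : Continuous fun g : SpecialLinearGroup (Idx n) ℝ => matSL g :=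
    SpecialLinearGroup.isClosedEmbedding_val.continuous
  -- for matrices preserving the form, positivity of the time coordinate on `hyp n` is equivalent
  -- to its nonnegativity, which is a closed condition
  have key : (SOp n : Set (SpecialLinearGroup (Idx n) ℝ)) =
      {g | (∀ x y, lor (matSL g *ᵥ x) (matSL g *ᵥ y) = lor x y) ∧
        ∀ x ∈ hyp n, 0 ≤ (matSL g *ᵥ x) (Sum.inr ())} := by
    ext g
    constructor
    · rintro ⟨h1, h2⟩
      exact ⟨h1, fun x hx => ((h2 x).2 hx).2.le⟩
    · rintro ⟨h1, h2⟩
      have h3 : ∀ x ∈ hyp n, 0 < (matSL g *ᵥ x) (Sum.inr ()) := by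
        intro x hx
        refine lt_of_le_of_ne (h2 x hx) fun h0 => ?_
        have h4 := sum_sq_of_lor_eq ((h1 x x).trans hx.1)
        have h5 : 0 ≤ ∑ i, (matSL g *ᵥ x) (Sum.inl i) ^ 2 :=
          Finset.sum_nonneg fun i _ => sq_nonneg _
        rw [← h0] at h4
        linarith
      refine ⟨h1, fun x => ⟨fun hx => ?_, fun hx => ⟨(h1 x x).trans hx.1, h3 x hx⟩⟩⟩
      have hxx : lor x x = -1 := (h1 x x).symm.trans hx.1
      refine ⟨hxx, ?_⟩
      by_contra hneg
      have h4 := sum_sq_of_lor_eq hxx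
      have h5 : 0 ≤ ∑ i, x (Sum.inl i) ^ 2 := Finset.sum_nonneg fun i _ => sq_nonneg _
      have h6 : -x ∈ hyp n := by
        refine ⟨?_, ?_⟩
        · rw [← neg_one_smul ℝ x, lor_smul_left, lor_smul_right, hxx]; norm_num
        · rw [Pi.neg_apply]
          rcases (not_lt.1 hneg).lt_or_eq with h | h
          · linarith
          · rw [h] at h4; linarith
      have h7 := h3 _ h6
      rw [mulVec_neg, Pi.neg_apply] at h7
      linarith [hx.2]
  rw [key]
  simp only [Set.ofPred_and, Set.ofPred_forall]
  refine IsClosed.inter ?_ ?_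
  · exact isClosed_iInter fun x => isClosed_iInter fun y =>
      isClosed_eq (continuous_lor_mulVec x y) continuous_const
  · refine isClosed_iInter fun x => isClosed_iInter fun _ => isClosed_le continuous_const ?_
    fun_prop

theorem isClosedEmbedding_mat (n : ℕ) :
    Topology.IsClosedEmbedding (mat : SOp n → Matrix (Idx n) (Idx n) ℝ) :=
  SpecialLinearGroup.isClosedEmbedding_val.comp (isClosed_SOp n).isClosedEmbedding_subtypeVal

theorem isCompact_coshDisp_le {n : ℕ} (B : ℝ) : IsCompact {g : SOp n | coshDisp g ≤ B} := by
  have hK : IsCompact (Set.univ.pi fun _ : Idx n => Set.univ.pi fun _ : Idx n =>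
      Set.Icc (-B) B) :=
    isCompact_univ_pi fun _ => isCompact_univ_pi fun _ => isCompact_Icc
  refine ((isClosedEmbedding_mat n).isCompact_preimage hK).of_isClosed_subset ?_ ?_
  · refine isClosed_le ?_ continuous_const
    exact (isClosedEmbedding_mat n).continuous.matrix_elem _ _
  · intro g hg a _ b _
    exact abs_le.1 ((abs_mat_le g a b).trans hg)

/-- A discrete group moves the base point a bounded distance only finitely often. -/
theorem finite_coshDisp_le {n : ℕ} (Γ : Subgroup (SOp n)) [DiscreteTopology Γ] (B : ℝ) :
    {γ : Γ | coshDisp γ.1 ≤ B}.Finite := by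
  have h := Subgroup.tendsto_coe_cofinite_of_discrete Γ ⟨inferInstance⟩
    (isCompact_coshDisp_le B).compl_mem_cocompact
  rw [Filter.mem_map, Filter.mem_cofinite] at h
  refine h.subset fun γ hγ => ?_
  simpa using hγ

/-- A torsion-free discrete group acts freely at the base point. -/
theorem eq_one_of_mem_stabO {n : ℕ} {Γ : Subgroup (SOp n)} [DiscreteTopology Γ]
    (hΓ : TorsionFree Γ) {γ : SOp n} (hγ : γ ∈ Γ) (h : γ ∈ stabO n) : γ = 1 := by
  have h1 : IsOfFinOrder (⟨γ, hγ⟩ : Γ) := by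
    rw [← finite_powers]
    refine (finite_coshDisp_le Γ 1).subset ?_
    rintro _ ⟨k, rfl⟩
    exact (coshDisp_of_mem_stabO (pow_mem h k)).le
  exact hΓ γ hγ ((Subgroup.subtype_injective Γ).isOfFinOrder_iff.2 h1)

/-- The nontrivial elements of a torsion-free discrete group have displacement at the base point
bounded away from zero. -/
theorem exists_gap {n : ℕ} {Γ : Subgroup (SOp n)} [DiscreteTopology Γ]
    (hΓ : TorsionFree Γ) : ∃ ε > 0, ∀ γ ∈ Γ, coshDisp γ < 1 + ε → γ = 1 := by
  have hfin : {γ : Γ | coshDisp γ.1 ≤ 2 ∧ γ ≠ 1}.Finite :=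
    (finite_coshDisp_le Γ 2).subset fun _ h => h.1
  obtain ⟨ε, hε, h⟩ : ∃ ε > 0, ∀ γ ∈ {γ : Γ | coshDisp γ.1 ≤ 2 ∧ γ ≠ 1}, 1 + ε ≤ coshDisp γ.1 := by
    rcases Set.eq_empty_or_nonempty {γ : Γ | coshDisp γ.1 ≤ 2 ∧ γ ≠ 1} with h0 | h0
    · exact ⟨1, one_pos, by simp [h0]⟩
    · obtain ⟨γ, hγ, hmin⟩ := hfin.exists_minimalFor (fun γ : Γ => coshDisp γ.1) _ h0
      refine ⟨coshDisp γ.1 - 1, ?_, fun δ hδ => ?_⟩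
      · refine sub_pos.2 (lt_of_le_of_ne (one_le_coshDisp _) fun h => hγ.2 ?_)
        exact Subtype.ext (eq_one_of_mem_stabO hΓ γ.2 (mem_stabO_of_coshDisp h.symm))
      · rcases le_total (coshDisp γ.1) (coshDisp δ.1) with h | h
        · simpa using h
        · simpa using hmin hδ h
  refine ⟨min ε 1, lt_min hε one_pos, fun γ hγ hlt => ?_⟩
  by_contra hne
  have h1 := h ⟨γ, hγ⟩ ⟨by linarith [min_le_right ε 1], fun h => hne (congrArg Subtype.val h)⟩
  dsimp only at h1
  linarith [min_le_left ε 1]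

/-! ### Cauchy–Schwarz in Minkowski space -/

/-- A quantitative reversed Cauchy–Schwarz inequality: for `x` on the hyperboloid and `z` future
causal, `-⟨z, O⟩` is at most `2 x_time` times `-⟨z, x⟩`. It allows the base point to be replaced by
any other point of hyperbolic space at the cost of a constant. -/
theorem time_le_of_causal {n : ℕ} {x z : Mink n} (hx : x ∈ hyp n) (hz : lor z z ≤ 0)
    (hz0 : 0 ≤ z (Sum.inr ())) : z (Sum.inr ()) ≤ 2 * x (Sum.inr ()) * -lor z x := by
  have hcs := Finset.sum_mul_sq_le_sq_mul_sq (Finset.univ : Finset (Fin (n + 1)))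
    (fun i => z (Sum.inl i)) (fun i => x (Sum.inl i))
  have h1 := sum_sq_of_lor_eq hx.1
  have h2 := sum_sq_of_lor_eq (x := z) rfl
  have h3 : 0 ≤ ∑ i, x (Sum.inl i) ^ 2 := Finset.sum_nonneg fun i _ => sq_nonneg _
  have hx0 := hx.2
  simp only [lor]
  set S := ∑ i, z (Sum.inl i) * x (Sum.inl i)
  rw [h1, h2] at hcs
  rw [h1] at h3
  set a := x (Sum.inr ())
  set b := z (Sum.inr ())
  have h4 : S ^ 2 ≤ b ^ 2 * (a ^ 2 + -1) :=
    hcs.trans (mul_le_mul_of_nonneg_right (by linarith) h3)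
  have h5 : (2 * a * S) ^ 2 ≤ (b * (2 * a ^ 2 - 1)) ^ 2 := by
    nlinarith [mul_le_mul_of_nonneg_left h4 (sq_nonneg a), sq_nonneg b]
  have h6 := (abs_le.1 (abs_le_of_sq_le_sq h5 (mul_nonneg hz0 (by linarith)))).2
  linarith

theorem neg_lor_le {n : ℕ} {x y : Mink n} (hx : x ∈ hyp n) (hy : y ∈ hyp n) :
    -lor x y ≤ 2 * x (Sum.inr ()) * y (Sum.inr ()) := by
  have hcs := Finset.sum_mul_sq_le_sq_mul_sq (Finset.univ : Finset (Fin (n + 1)))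
    (fun i => x (Sum.inl i)) (fun i => y (Sum.inl i))
  rw [sum_sq_of_lor_eq hx.1, sum_sq_of_lor_eq hy.1] at hcs
  have hx0 := hx.2
  have hy0 := hy.2
  have h3 : 0 ≤ ∑ i, x (Sum.inl i) ^ 2 := Finset.sum_nonneg fun i _ => sq_nonneg _
  have h4 : 0 ≤ ∑ i, y (Sum.inl i) ^ 2 := Finset.sum_nonneg fun i _ => sq_nonneg _
  rw [sum_sq_of_lor_eq hx.1] at h3
  rw [sum_sq_of_lor_eq hy.1] at h4
  simp only [lor]
  set S := ∑ i, x (Sum.inl i) * y (Sum.inl i)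
  have h5 : S ^ 2 ≤ (x (Sum.inr ()) * y (Sum.inr ())) ^ 2 := by nlinarith
  have h6 := (abs_le.1 (abs_le_of_sq_le_sq h5 (by positivity))).1
  linarith

theorem orbit_mem_hyp {n : ℕ} (g : SOp n) : mat g *ᵥ basePt n ∈ hyp n :=
  (mat_mem_hyp g _).2 (basePt_mem n)

theorem orbit_time {n : ℕ} (g : SOp n) : (mat g *ᵥ basePt n) (Sum.inr ()) = coshDisp g :=
  mat_mulVec_basePt g _

theorem time_mat_mulVec_le {n : ℕ} (g : SOp n) {x : Mink n} (hx : x ∈ hyp n) :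
    (mat g *ᵥ x) (Sum.inr ()) ≤ 2 * coshDisp g * x (Sum.inr ()) := by
  have h := neg_lor_le (orbit_mem_hyp g⁻¹) hx
  rwa [← lor_mat_right, lor_base_left, neg_neg, orbit_time, coshDisp_inv] at h

theorem coshDisp_le_mul_right {n : ℕ} (γ g : SOp n) :
    coshDisp γ ≤ 2 * coshDisp g * coshDisp (γ * g) := by
  have h := time_le_of_causal (orbit_mem_hyp g) ((orbit_mem_hyp γ⁻¹).1.trans_le (by norm_num))
    (orbit_mem_hyp γ⁻¹).2.le
  rwa [orbit_time, orbit_time, coshDisp_inv, ← lor_mat_right, ← mat_mul_mulVec,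
    ← coshDisp_eq] at h

/-! ### Horospherical coordinates at a boundary point -/

theorem neg_lor_vec_pos {n : ℕ} (ξ : Bdry n) {x : Mink n} (hx : x ∈ hyp n) :
    0 < -lor x ξ.vec := by
  linarith [(lor_neg_of_hyp ξ hx.1).1 hx.2]

theorem mat_inv_mulVec_vec {n : ℕ} {ξ : Bdry n} {γ : SOp n} {c : ℝ} (hc : c ≠ 0)
    (h : mat γ *ᵥ ξ.vec = c • ξ.vec) : mat γ⁻¹ *ᵥ ξ.vec = c⁻¹ • ξ.vec := by
  have h1 := mat_inv_mulVec γ ξ.vec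
  rw [h, mulVec_smul] at h1
  conv_rhs => rw [← h1]
  rw [smul_smul, inv_mul_cancel₀ hc, one_smul]

theorem lor_mat_vec {n : ℕ} {ξ : Bdry n} {γ : SOp n} {c : ℝ} (hc : c ≠ 0)
    (h : mat γ *ᵥ ξ.vec = c • ξ.vec) (x : Mink n) :
    lor (mat γ *ᵥ x) ξ.vec = c⁻¹ * lor x ξ.vec := by
  rw [lor_mat_left, mat_inv_mulVec_vec hc h, lor_smul_right]

theorem lor_mat_vec_of_fix {n : ℕ} {ξ : Bdry n} {γ : SOp n} (h : mat γ *ᵥ ξ.vec = ξ.vec)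
    (x : Mink n) : lor (mat γ *ᵥ x) ξ.vec = lor x ξ.vec := by
  rw [lor_mat_vec one_ne_zero (by rw [h, one_smul]), inv_one, one_mul]

/-- The projection of `x` to the horosphere `ℋ_ξ(1)` along the geodesics ending at `ξ`. -/
def horoProj {n : ℕ} (ξ : Bdry n) (x : Mink n) : Mink n :=
  (-lor x ξ.vec)⁻¹ • x + ((1 - ((-lor x ξ.vec)⁻¹) ^ 2) / 2) • ξ.vec

theorem horoProj_mem {n : ℕ} (ξ : Bdry n) {x : Mink n} (hx : x ∈ hyp n) :
    horoProj ξ x ∈ horosphere ξ := by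
  have hq : lor x ξ.vec ≠ 0 := (neg_pos.1 (neg_lor_vec_pos ξ hx)).ne
  have h1 : lor (horoProj ξ x) ξ.vec = -1 := by
    rw [horoProj, lor_add_left, lor_smul_left, lor_smul_left, ξ.null]
    field_simp
    ring
  have h2 : lor (horoProj ξ x) (horoProj ξ x) = -1 := by
    conv_lhs => rw [horoProj]
    simp only [lor_add_left, lor_add_right, lor_smul_left, lor_smul_right, ξ.null, hx.1,
      lor_comm ξ.vec x]
    field_simp
    ring
  exact ⟨⟨h2, (lor_neg_of_hyp ξ h2).2 (by rw [h1]; norm_num)⟩, h1⟩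

theorem mat_horoProj {n : ℕ} {ξ : Bdry n} {γ : SOp n} (h : mat γ *ᵥ ξ.vec = ξ.vec)
    (x : Mink n) : mat γ *ᵥ horoProj ξ x = horoProj ξ (mat γ *ᵥ x) := by
  rw [horoProj, horoProj, lor_mat_vec_of_fix h, mulVec_add, mulVec_smul, mulVec_smul, h]

/-- For an isometry fixing the light-like vector `ξ`, the excess of `cosh (displacement)` over `1`
at a point of height `h = (-⟨x, ξ⟩)⁻¹` is `h⁻²` times its value at the projection to the
horosphere. -/
theorem neg_lor_mat_eq {n : ℕ} {ξ : Bdry n} {β : SOp n} (h : mat β *ᵥ ξ.vec = ξ.vec)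
    {x : Mink n} (hx : x ∈ hyp n) : -lor x (mat β *ᵥ x) =
      1 + (-lor x ξ.vec) ^ 2 * (-lor (horoProj ξ x) (mat β *ᵥ horoProj ξ x) - 1) := by
  have hq : lor x ξ.vec ≠ 0 := (neg_pos.1 (neg_lor_vec_pos ξ hx)).ne
  rw [mat_horoProj h]
  simp only [horoProj, lor_mat_vec_of_fix h, lor_add_left, lor_add_right, lor_smul_left,
    lor_smul_right, ξ.null, lor_comm ξ.vec (mat β *ᵥ x)]
  field_simp
  ring

/-! ### Full rank cusps -/

theorem mem_parab_of_fix {n : ℕ} {ξ : Bdry n} {γ : SOp n} (h : mat γ *ᵥ ξ.vec = ξ.vec) :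
    γ ∈ parab ξ := ⟨1, one_pos, by rw [h, one_smul]⟩

/-- The elements of `Γ` which witness cocompactness on the horosphere fix the light-like vector
`ξ`, not just the ray it spans. -/
theorem exists_bounded_translate {n : ℕ} {Γ : Subgroup (SOp n)} {ξ : Bdry n}
    (hξ : IsFullRankParabolicPt Γ ξ) : ∃ M : ℝ, ∀ x ∈ horosphere ξ, ∃ γ ∈ Γ,
      mat γ *ᵥ ξ.vec = ξ.vec ∧ (mat γ *ᵥ x) (Sum.inr ()) ≤ M := by
  obtain ⟨-, C, hC, hCsub, h⟩ := hξ
  obtain ⟨M, hM⟩ := (hC.image (continuous_apply (Sum.inr ()))).bddAbove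
  refine ⟨M, fun x hx => ?_⟩
  obtain ⟨γ, ⟨hγ, c, hc, hcξ⟩, hγC⟩ := h x hx
  refine ⟨γ, hγ, ?_, hM ⟨_, hγC, rfl⟩⟩
  have h1 := (hCsub hγC).2
  rw [lor_mat_vec hc.ne' hcξ, hx.2] at h1
  have h2 : c⁻¹ = 1 := by linarith
  rw [hcξ, inv_eq_one.1 h2, one_smul]

theorem exists_ne_one_fix {n : ℕ} (hn : 1 ≤ n) {Γ : Subgroup (SOp n)} {ξ : Bdry n}
    (hξ : IsFullRankParabolicPt Γ ξ) {e : Fin n → Mink n} (he : IsFrame ξ e) :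
    ∃ β ∈ Γ, β ≠ 1 ∧ mat β *ᵥ ξ.vec = ξ.vec := by
  obtain ⟨M, hM⟩ := exists_bounded_translate hξ
  -- the horosphere contains points with arbitrarily large time coordinate
  set v := e ⟨0, hn⟩
  have h0 : lor v (basePt n) = 0 := he.1 _
  have h1 : lor v ξ.vec = 0 := he.2.1 _
  have h2 : lor v v = 1 := by simp [v, he.2.2]
  set r : ℝ := 1 + |M|
  set x : Mink n := basePt n + r • v + (r ^ 2 / 2) • ξ.vec with hx
  have hxξ : lor x ξ.vec = -1 := by
    simp [hx, lor_add_left, lor_smul_left, ξ.null, h1, lor_base_vec]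
  have hxx : lor x x = -1 := by
    simp only [hx, lor_add_left, lor_add_right, lor_smul_left, lor_smul_right, ξ.null, h0, h1, h2,
      lor_base_vec, lor_base_base, lor_comm ξ.vec, lor_comm (basePt n) v]
    ring
  have hxt : x (Sum.inr ()) = 1 + r ^ 2 / 2 := by
    have h3 := lor_base_right x
    rw [hx] at h3
    simp only [lor_add_left, lor_smul_left, h0, lor_base_base, lor_comm ξ.vec, lor_base_vec] at h3
    rw [← hx] at h3
    linarith
  obtain ⟨β, hβ, hfix, hle⟩ := hM x ⟨⟨hxx, by rw [hxt]; positivity⟩, hxξ⟩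
  refine ⟨β, hβ, ?_, hfix⟩
  rintro rfl
  rw [mat_one, one_mulVec, hxt] at hle
  nlinarith [le_abs_self M, sq_nonneg (|M|), abs_nonneg M, sq_nonneg (|M| - 1)]

/-- The orbit `Γ O` stays away from the cusp: it avoids a horoball at `ξ`. A deep orbit point could
be moved by `Γ_ξ` above a compact part of the horosphere, where a fixed parabolic element displaces
it by an arbitrarily small amount, contradicting discreteness. -/
theorem exists_horoball_avoiding_orbit {n : ℕ} (hn : 1 ≤ n) {Γ : Subgroup (SOp n)}
    [DiscreteTopology Γ] (hΓ : TorsionFree Γ) {ξ : Bdry n} (hξ : IsFullRankParabolicPt Γ ξ)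
    {e : Fin n → Mink n} (he : IsFrame ξ e) :
    ∃ q > 0, ∀ γ ∈ Γ, q ≤ -lor (mat γ *ᵥ basePt n) ξ.vec := by
  obtain ⟨M, hM⟩ := exists_bounded_translate hξ
  obtain ⟨β, hβ, hβ1, hβξ⟩ := exists_ne_one_fix hn hξ he
  obtain ⟨ε, hε, hgap⟩ := exists_gap hΓ
  set B := 4 * coshDisp β * M ^ 2 with hB
  have hβd := one_le_coshDisp β
  have hB0 : 0 ≤ B := by positivity
  refine ⟨Real.sqrt (ε / (B + 1)), by positivity, fun γ hγ => ?_⟩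
  by_contra hlt
  rw [not_le] at hlt
  have hq := neg_lor_vec_pos ξ (orbit_mem_hyp γ)
  obtain ⟨δ, hδ, hδξ, hle⟩ := hM _ (horoProj_mem ξ (orbit_mem_hyp γ))
  rw [mat_horoProj hδξ, ← mat_mul_mulVec] at hle
  have hqq : lor (mat (δ * γ) *ᵥ basePt n) ξ.vec = lor (mat γ *ᵥ basePt n) ξ.vec := by
    rw [mat_mul_mulVec, lor_mat_vec_of_fix hδξ]
  have hdisp := neg_lor_mat_eq hβξ (orbit_mem_hyp (δ * γ))
  rw [hqq] at hdisp
  set q := -lor (mat γ *ᵥ basePt n) ξ.vec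
  set p := horoProj ξ (mat (δ * γ) *ᵥ basePt n)
  have hp : p ∈ hyp n := (horoProj_mem ξ (orbit_mem_hyp (δ * γ))).1
  have hpB : -lor p (mat β *ᵥ p) ≤ B := by
    refine (neg_lor_le hp ((mat_mem_hyp β p).2 hp)).trans ?_
    have h1 := time_mat_mulVec_le β hp
    have h2 := hp.2
    calc 2 * p (Sum.inr ()) * (mat β *ᵥ p) (Sum.inr ())
        ≤ 2 * p (Sum.inr ()) * (2 * coshDisp β * p (Sum.inr ())) := by gcongr
      _ = 4 * coshDisp β * p (Sum.inr ()) ^ 2 := by ring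
      _ ≤ B := by rw [hB]; gcongr
  have hq2 : q ^ 2 * (B + 1) < ε := by
    have h1 := (Real.lt_sqrt hq.le).1 hlt
    rwa [lt_div_iff₀ (by positivity)] at h1
  -- the conjugate of `β` by `δ γ` displaces `O` as much as `β` displaces `δ γ O`
  have hone := hgap ((δ * γ)⁻¹ * β * (δ * γ))
    (Γ.mul_mem (Γ.mul_mem (Γ.inv_mem (Γ.mul_mem hδ hγ)) hβ) (Γ.mul_mem hδ hγ)) (by
      rw [coshDisp_eq, mul_assoc, mat_mul_mulVec, lor_mat_right, inv_inv, mat_mul_mulVec β, hdisp]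
      nlinarith [mul_le_mul_of_nonneg_left hpB (sq_nonneg q), sq_nonneg q])
  refine hβ1 ?_
  have h1 : β = (δ * γ) * ((δ * γ)⁻¹ * β * (δ * γ)) * (δ * γ)⁻¹ := by group
  rw [h1, hone]
  group

/-- The stabilizer of a full rank cusp contains no element translating along a geodesic: it fixes
the light-like vector `ξ`. -/
theorem fix_vec_of_mem_parab {n : ℕ} (hn : 1 ≤ n) {Γ : Subgroup (SOp n)}
    [DiscreteTopology Γ] (hΓ : TorsionFree Γ) {ξ : Bdry n} (hξ : IsFullRankParabolicPt Γ ξ)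
    {e : Fin n → Mink n} (he : IsFrame ξ e) {γ : SOp n} (hγ : γ ∈ Γ ⊓ parab ξ) :
    mat γ *ᵥ ξ.vec = ξ.vec := by
  obtain ⟨q, hq, hbound⟩ := exists_horoball_avoiding_orbit hn hΓ hξ he
  have key : ∀ (δ : SOp n) (c : ℝ), δ ∈ Γ → 0 < c → mat δ *ᵥ ξ.vec = c • ξ.vec → 1 ≤ c⁻¹ := by
    intro δ c hδ hc hδξ
    by_contra hlt
    obtain ⟨k, hk⟩ := exists_pow_lt_of_lt_one hq (not_le.1 hlt)
    have hpow : mat (δ ^ k) *ᵥ ξ.vec = (c ^ k) • ξ.vec := by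
      clear hk
      induction k with
      | zero => simp [mat_one]
      | succ k ih => rw [pow_succ, mat_mul_mulVec, hδξ, mulVec_smul, ih, smul_smul, pow_succ,
          mul_comm]
    have h1 := hbound _ (Γ.pow_mem hδ k)
    rw [lor_mat_vec (pow_pos hc k).ne' hpow, lor_base_vec, ← inv_pow] at h1
    linarith
  obtain ⟨hγΓ, c, hc, hcξ⟩ := hγ
  have h1 := key γ c hγΓ hc hcξ
  have h2 := key γ⁻¹ c⁻¹ (Γ.inv_mem hγΓ) (inv_pos.2 hc) (mat_inv_mulVec_vec hc.ne' hcξ)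
  rw [inv_inv] at h2
  rw [hcξ, le_antisymm ((one_le_inv₀ hc).1 h1) h2, one_smul]

/-- Every coset in `Γ_ξ \ Γ` has a representative `δ γ` whose orbit point is as close to `O` as the
horospherical height of `γ g O` permits. -/
theorem exists_rep_coshDisp_le {n : ℕ} (hn : 1 ≤ n) {Γ : Subgroup (SOp n)}
    [DiscreteTopology Γ] (hΓ : TorsionFree Γ) {ξ : Bdry n} (hξ : IsFullRankParabolicPt Γ ξ)
    {e : Fin n → Mink n} (he : IsFrame ξ e) (g : SOp n) :
    ∃ C > 0, ∀ γ ∈ Γ, ∃ δ ∈ Γ ⊓ parab ξ,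
      coshDisp (δ * γ) ≤ C * -lor (mat (γ * g) *ᵥ basePt n) ξ.vec := by
  obtain ⟨M, hM⟩ := exists_bounded_translate hξ
  obtain ⟨q₀, hq₀, hbound⟩ := exists_horoball_avoiding_orbit hn hΓ hξ he
  have hg := one_le_coshDisp g
  -- `q₁` bounds `q(γ g)` from below, uniformly in `γ`
  set q₁ := q₀ / (2 * coshDisp g) with hq₁
  have hq₁0 : 0 < q₁ := by positivity
  refine ⟨2 * coshDisp g * (|M| + (q₁⁻¹) ^ 2 / 2), by positivity, fun γ hγ => ?_⟩
  have hqpos := neg_lor_vec_pos ξ (orbit_mem_hyp (γ * g))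
  obtain ⟨δ, hδ, hδξ, hle⟩ := hM _ (horoProj_mem ξ (orbit_mem_hyp (γ * g)))
  refine ⟨δ, ⟨hδ, mem_parab_of_fix hδξ⟩, ?_⟩
  have hq₁le : q₁ ≤ -lor (mat (γ * g) *ᵥ basePt n) ξ.vec := by
    have h1 := hbound γ hγ
    have h2 : -lor (mat γ *ᵥ basePt n) ξ.vec = (mat γ⁻¹ *ᵥ ξ.vec) (Sum.inr ()) := by
      rw [lor_mat_left, lor_base_left, neg_neg]
    have h3 := time_le_of_causal (orbit_mem_hyp g) (z := mat γ⁻¹ *ᵥ ξ.vec)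
      (by rw [lor_mat, ξ.null]) (by rw [← h2]; exact hq₀.le.trans h1)
    rw [← h2, orbit_time, ← lor_mat_right, ← mat_mul_mulVec, lor_comm ξ.vec] at h3
    rw [hq₁, div_le_iff₀ (by positivity)]
    linarith
  rw [mat_horoProj hδξ, ← mat_mul_mulVec, horoProj, mat_mul_mulVec, lor_mat_vec_of_fix hδξ,
    ← mat_mul_mulVec] at hle
  simp only [Pi.add_apply, Pi.smul_apply, smul_eq_mul, ξ.time, orbit_time] at hle
  set q := -lor (mat (γ * g) *ᵥ basePt n) ξ.vec
  have hinv : q⁻¹ ^ 2 ≤ q₁⁻¹ ^ 2 := by gcongr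
  have h4 : coshDisp (δ * (γ * g)) ≤ q * (|M| + (q₁⁻¹) ^ 2 / 2) := by
    have h5 : q⁻¹ * coshDisp (δ * (γ * g)) ≤ |M| + (q₁⁻¹) ^ 2 / 2 := by
      linarith [le_abs_self M]
    rwa [inv_mul_le_iff₀ hqpos] at h5
  have h6 := coshDisp_le_mul_right (δ * γ) g
  rw [mul_assoc δ] at h6
  calc coshDisp (δ * γ) ≤ 2 * coshDisp g * coshDisp (δ * (γ * g)) := h6
    _ ≤ 2 * coshDisp g * (q * (|M| + (q₁⁻¹) ^ 2 / 2)) := by gcongr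
    _ = _ := by ring

/-! ### The Iwasawa components -/

theorem two_smul_wedgeMat_mulVec {n : ℕ} (ξ : Bdry n) (w : Mink n) :
    ((2 : ℝ) • wedgeMat ξ.vec (basePt n)) *ᵥ w =
      (2 * lor ξ.vec w) • basePt n - (2 * lor (basePt n) w) • ξ.vec := by
  rw [smul_mulVec, wedgeMat_mulVec, smul_sub, smul_smul, smul_smul]

/-- Elements of `𝔫_ξ` annihilate the light-like vector `ξ`, since `T_ξ` would multiply its image
by `4` while the eigenvalues of `T_ξ` on Minkowski space are `-2, 0, 2`. -/
theorem rootSp_two_mulVec {n : ℕ} {ξ : Bdry n} {X : LieG n} (hX : X ∈ rootSp ξ 2) :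
    X.1 *ᵥ ξ.vec = 0 := by
  rw [rootSp, Module.End.mem_eigenspace_iff] at hX
  have h : ((2 : ℝ) • wedgeMat ξ.vec (basePt n)) * X.1 -
      X.1 * ((2 : ℝ) • wedgeMat ξ.vec (basePt n)) = (2 : ℝ) • X.1 := congrArg Subtype.val hX
  have h1 := congrArg (fun M => M *ᵥ ξ.vec) h
  simp only [sub_mulVec, ← mulVec_mulVec, smul_mulVec (2 : ℝ) X.1] at h1
  rw [two_smul_wedgeMat_mulVec, two_smul_wedgeMat_mulVec, ξ.null, lor_base_vec] at h1
  set w := X.1 *ᵥ ξ.vec with hw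
  simp only [mulVec_sub, mulVec_smul, ← hw] at h1
  have h2 : (4 : ℝ) • w = (2 * lor ξ.vec w) • basePt n - (2 * lor (basePt n) w) • ξ.vec := by
    rw [← sub_eq_zero] at h1 ⊢
    rw [← neg_eq_zero, ← h1]
    module
  have h3 := congrArg (fun y => lor y ξ.vec) h2
  have h4 := congrArg (fun y => lor y (basePt n)) h2
  simp only [lor_smul_left, lor_sub_left, ξ.null, lor_base_vec, lor_base_base,
    lor_comm w, lor_comm ξ.vec (basePt n)] at h3 h4
  have h5 : lor ξ.vec w = 0 := by linarith
  rw [h5] at h2 h4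
  have h6 : lor (basePt n) w = 0 := by linarith
  rw [h6] at h2
  simpa using h2

theorem unip_fix {n : ℕ} {ξ : Bdry n} {u : SOp n} (hu : u ∈ unip ξ) :
    mat u *ᵥ ξ.vec = ξ.vec := by
  obtain ⟨X, hX, h⟩ := hu
  rw [h, add_mulVec, add_mulVec, smul_mulVec, ← mulVec_mulVec, rootSp_two_mulVec hX]
  simp

theorem IsTransl.mem_parab {n : ℕ} {ξ : Bdry n} {t : ℝ} {a : SOp n} (h : IsTransl ξ t a) :
    a ∈ parab ξ := ⟨t ^ 2, pow_pos h.1 2, h.2.1⟩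

theorem iwT_pos {n : ℕ} (ξ : Bdry n) (g : SOp n) : 0 < iwT ξ g := by
  obtain ⟨_, _, _, ha, _⟩ := iwasawa_spec ξ g
  exact ha.1

/-- The height `t_ξ(a)²` of `g = n a k` is read off from the orbit point `g O`. -/
theorem iwT_sq {n : ℕ} (ξ : Bdry n) (g : SOp n) :
    iwT ξ g ^ 2 = (-lor (mat g *ᵥ basePt n) ξ.vec)⁻¹ := by
  obtain ⟨u, a, hu, ha, hk, hg⟩ := iwasawa_spec ξ g
  have h : lor (mat g *ᵥ basePt n) ξ.vec = -(iwT ξ g ^ 2)⁻¹ := by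
    conv_lhs => rw [hg, mat_mul_mulVec, (mem_stabO_iff _).1 hk, mat_mul_mulVec,
      lor_mat_vec_of_fix (unip_fix hu), lor_mat_vec (pow_pos ha.1 2).ne' ha.2.1, lor_base_vec]
    ring
  rw [h, neg_neg, inv_inv]

theorem iwK_mem {n : ℕ} (ξ : Bdry n) (g : SOp n) : iwK ξ g ∈ stabO n := by
  obtain ⟨_, _, _, _, hk, _⟩ := iwasawa_spec ξ g
  exact hk

theorem fix_of_mem_parab_stabO {n : ℕ} {ξ : Bdry n} {m : SOp n} (hp : m ∈ parab ξ)
    (hk : m ∈ stabO n) : mat m *ᵥ ξ.vec = ξ.vec := by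
  obtain ⟨c, hc, h⟩ := hp
  have h1 := lor_mat_vec hc.ne' h (basePt n)
  rw [(mem_stabO_iff m).1 hk, lor_base_vec] at h1
  have h2 : c⁻¹ = 1 := by linarith
  rw [h, inv_eq_one.1 h2, one_smul]

theorem iwK_mul_inv_mem_parab {n : ℕ} {ξ : Bdry n} {γ : SOp n} (hγ : γ ∈ parab ξ) (g : SOp n) :
    iwK ξ (γ * g) * (iwK ξ g)⁻¹ ∈ parab ξ := by
  obtain ⟨u, a, hu, ha, -, hg⟩ := iwasawa_spec ξ g
  obtain ⟨u', a', hu', ha', -, hg'⟩ := iwasawa_spec ξ (γ * g)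
  have hu := mem_parab_of_fix (unip_fix hu)
  have hu' := mem_parab_of_fix (unip_fix hu')
  have h : iwK ξ (γ * g) * (iwK ξ g)⁻¹ = (u' * a')⁻¹ * γ * (u * a) := by
    have h1 : iwK ξ (γ * g) = (u' * a')⁻¹ * (γ * g) := by
      rw [eq_inv_mul_iff_mul_eq]; exact hg'.symm
    have h2 : g * (iwK ξ g)⁻¹ = u * a := by rw [mul_inv_eq_iff_eq_mul]; exact hg
    rw [h1, ← h2]; group
  rw [h]
  exact mul_mem (mul_mem (inv_mem (mul_mem hu' ha'.mem_parab)) hγ) (mul_mem hu ha.mem_parab)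

/-! ### The values of the form -/

theorem adRep_mulVec_basePt {n : ℕ} {k : SOp n} (hk : k ∈ stabO n) (X : LieG n) :
    (adRep n k X).1 *ᵥ basePt n = mat k *ᵥ (X.1 *ᵥ basePt n) := by
  change (mat k * X.1 * mat k⁻¹) *ᵥ basePt n = _
  rw [← mulVec_mulVec, (mem_stabO_iff _).1 (inv_mem hk), ← mulVec_mulVec]

/-- The value of `(Ad^*(k⁻¹) ⊗ ρ(k⁻¹)) ((u_1^* ∧ … ∧ u_n^*) ⊗ v)` as a Gram determinant. Since `k`
fixes `O`, the argument `k X k⁻¹ O` of the coframe simplifies to `k X O`. -/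
theorem coAct_initVal_apply {n : ℕ} {V : Type} [AddCommGroup V] [Module ℝ V]
    (ρ : Representation ℝ (SOp n) V) (e : Fin n → Mink n) (v : V) {k : SOp n} (hk : k ∈ stabO n)
    (X : Fin n → LieG n) : coAct ρ k⁻¹ (initVal e v) X =
      (Matrix.of fun j i => lor (e i) (mat k *ᵥ ((X j).1 *ᵥ basePt n))).det • ρ k⁻¹ v := by
  have h : (fun j => coframe e (adRep n k (X j))) =
      fun j i => lor (e i) (mat k *ᵥ ((X j).1 *ᵥ basePt n)) := by
    funext j i
    rw [← adRep_mulVec_basePt hk]; rfl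
  simp only [coAct, inv_inv]
  rw [← h, ← map_smul]
  rfl

/-- An orientation preserving isometry fixing `O` and `ξ` acts with determinant one on the
orthogonal complement of `O` and `ξ`. This is stated as the invariance of the Gram determinants
against a tuple `e` in that complement. -/
theorem det_lor_mat {n : ℕ} {ξ : Bdry n} {e : Fin n → Mink n} (he0 : ∀ i, lor (e i) (basePt n) = 0)
    (he1 : ∀ i, lor (e i) ξ.vec = 0) {m : SOp n} (hO : mat m *ᵥ basePt n = basePt n)
    (hm : mat m *ᵥ ξ.vec = ξ.vec) (y : Fin n → Mink n) :
    (Matrix.of fun j i => lor (e i) (mat m *ᵥ y j)).det =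
      (Matrix.of fun j i => lor (e i) (y j)).det := by
  have σ : Idx n ≃ Fin n ⊕ Fin 2 := Fintype.equivOfCardEq (by simp [Idx])
  -- complete a tuple to a square matrix whose last rows are `O` and `ξ`
  let R : (Fin n → Mink n) → Matrix (Idx n) (Idx n) ℝ :=
    fun y => Matrix.of fun a => Sum.elim y ![basePt n, ξ.vec] (σ a)
  let J := LieAlgebra.Orthogonal.indefiniteDiagonal (Fin (n + 1)) Unit ℝ
  have key : ∀ y : Fin n → Mink n,
      (R y).det * (J.det * (R e).det) = -(Matrix.of fun j i => lor (e i) (y j)).det := by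
    intro y
    have h1 : R y * (J * (R e)ᵀ) = (fromBlocks (Matrix.of fun j i => lor (e i) (y j))
        (Matrix.of fun j l => lor (y j) (![basePt n, ξ.vec] l)) 0
        !![-1, -1; -1, 0]).submatrix σ σ := by
      ext a b
      have h2 : (R y * (J * (R e)ᵀ)) a b = lor (Sum.elim y ![basePt n, ξ.vec] (σ a))
          (Sum.elim e ![basePt n, ξ.vec] (σ b)) := by
        rw [lor_eq_dot]; rfl
      rw [h2, submatrix_apply]
      rcases σ a with j | l <;> rcases σ b with i | l'
      · simp [lor_comm]
      · simp
      · fin_cases l <;> simp [lor_comm _ (e i), he0, he1]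
      · fin_cases l <;> fin_cases l' <;>
          simp [lor_base_base, lor_base_vec, ξ.null, lor_comm ξ.vec (basePt n)]
    have h3 := congrArg Matrix.det h1
    rw [det_mul, det_mul, det_transpose, det_submatrix_equiv_self, det_fromBlocks_zero₂₁,
      det_fin_two_of] at h3
    rw [h3]; ring
  have hR : R (fun j => mat m *ᵥ y j) = R y * (mat m)ᵀ := by
    ext a b
    change _ = (R y a) ⬝ᵥ (mat m b)
    rw [dotProduct_comm]
    change _ = (mat m *ᵥ (R y a)) b
    change Sum.elim (fun j => mat m *ᵥ y j) ![basePt n, ξ.vec] (σ a) b =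
      (mat m *ᵥ (Sum.elim y ![basePt n, ξ.vec] (σ a))) b
    rcases σ a with j | l
    · rfl
    · fin_cases l
      · simp [hO]
      · simp [hm]
  have h1 := key fun j => mat m *ᵥ y j
  have hdet : (mat m).det = 1 := m.1.2
  rw [hR, det_mul, det_transpose, hdet, mul_one, key y] at h1
  exact (neg_injective h1).symm

/-- For the trivial representation, `φ_{ξ,s}` is invariant under the isometries fixing the
light-like vector `ξ`. -/
theorem phi_trivial_mul_left {n : ℕ} {ξ : Bdry n} {e : Fin n → Mink n} (he : IsFrame ξ e) (s : ℝ)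
    {γ : SOp n} (hγ : mat γ *ᵥ ξ.vec = ξ.vec) (g : SOp n) :
    phi (Representation.trivial ℝ (SOp n) ℝ) ξ e 1 s (γ * g) =
      phi (Representation.trivial ℝ (SOp n) ℝ) ξ e 1 s g := by
  have ht : iwT ξ (γ * g) = iwT ξ g := by
    rw [← sq_eq_sq₀ (iwT_pos _ _).le (iwT_pos _ _).le, iwT_sq, iwT_sq, mat_mul_mulVec,
      lor_mat_vec_of_fix hγ]
  have hmp := iwK_mul_inv_mem_parab (mem_parab_of_fix hγ) g
  have hmk := mul_mem (iwK_mem ξ (γ * g)) (inv_mem (iwK_mem ξ g))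
  rw [phi, phi, ht]
  refine congrArg _ (AlternatingMap.ext fun X => ?_)
  rw [coAct_initVal_apply _ _ _ (iwK_mem ξ _), coAct_initVal_apply _ _ _ (iwK_mem ξ _)]
  have h := det_lor_mat he.1 he.2.1 ((mem_stabO_iff _).1 hmk) (fix_of_mem_parab_stabO hmp hmk)
    (fun j => mat (iwK ξ g) *ᵥ ((X j).1 *ᵥ basePt n))
  have hk : ∀ x, mat (iwK ξ (γ * g) * (iwK ξ g)⁻¹) *ᵥ (mat (iwK ξ g) *ᵥ x) =
      mat (iwK ξ (γ * g)) *ᵥ x := fun x => by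
    rw [← mat_mul_mulVec, inv_mul_cancel_right]
  simp only [hk] at h
  rw [h]
  rfl

/-! ### Boundedness over the maximal compact subgroup -/

/-- On a finite-dimensional space, a family is bounded in every seminorm as soon as it is bounded
under a separating set of linear functionals. -/
theorem exists_seminorm_le {E I J : Type*} [AddCommGroup E] [Module ℝ E] [FiniteDimensional ℝ E]
    (F : I → Module.Dual ℝ E) (hF : ∀ x, (∀ i, F i x = 0) → x = 0) (f : J → E)
    (hf : ∀ i, ∃ B, ∀ j, |F i (f j)| ≤ B) (N : Seminorm ℝ E) : ∃ B, ∀ j, N (f j) ≤ B := by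
  -- the functionals bounded on the family form a subspace of the dual, which separates points
  let W : Submodule ℝ (Module.Dual ℝ E) :=
    { carrier := {ψ | ∃ B, ∀ j, |ψ (f j)| ≤ B}
      zero_mem' := ⟨0, fun j => by simp⟩
      add_mem' := by
        rintro ψ χ ⟨B, hB⟩ ⟨C, hC⟩
        exact ⟨B + C, fun j => (abs_add_le _ _).trans (add_le_add (hB j) (hC j))⟩
      smul_mem' := by
        rintro c ψ ⟨B, hB⟩
        refine ⟨|c| * B, fun j => ?_⟩
        rw [LinearMap.smul_apply, smul_eq_mul, abs_mul]
        exact mul_le_mul_of_nonneg_left (hB j) (abs_nonneg c) }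
  have hW : W = ⊤ := by
    have h : W.dualCoannihilator = ⊥ := by
      rw [eq_bot_iff]
      intro x hx
      exact hF x fun i => (Submodule.mem_dualCoannihilator x).1 hx _ (hf i)
    rw [← Subspace.dualCoannihilator_dualAnnihilator_eq (W := W), h, Submodule.dualAnnihilator_bot]
  let b := Module.finBasis ℝ E
  have hb : ∀ l, ∃ B, ∀ j, |b.coord l (f j)| ≤ B := fun l => by
    have : b.coord l ∈ W := hW ▸ Submodule.mem_top
    exact this
  choose B hB using hb
  refine ⟨∑ l, B l * N (b l), fun j => ?_⟩
  conv_lhs => rw [← b.sum_repr (f j)]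
  refine (Finset.le_sum_of_subadditive N (map_zero N).le (map_add_le_add N) _ _).trans
    (Finset.sum_le_sum fun l _ => ?_)
  rw [map_smul_eq_mul]
  exact mul_le_mul_of_nonneg_right (hB l j) (apply_nonneg N _)

instance formVal_finite (n : ℕ) (V : Type) [AddCommGroup V] [Module ℝ V] [FiniteDimensional ℝ V] :
    FiniteDimensional ℝ (FormVal n V) :=
  Module.Finite.of_injective
    (AlternatingMap.toMultilinearMapLM (S := ℝ) : FormVal n V →ₗ[ℝ] _)
    AlternatingMap.coe_multilinearMap_injective

theorem exists_abs_det_lor_le {n : ℕ} (e y : Fin n → Mink n) : ∃ B : ℝ, ∀ k ∈ stabO n,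
    |(Matrix.of fun j i => lor (e i) (mat k *ᵥ y j)).det| ≤ B := by
  have hentry : ∀ k ∈ stabO n, ∀ j i, |lor (e i) (mat k *ᵥ y j)| ≤
      ∑ j, ∑ i, (∑ a, |e i a|) * ∑ b, |y j b| := by
    intro k hk j i
    have h1 : |lor (e i) (mat k *ᵥ y j)| ≤ (∑ a, |e i a|) * ∑ b, |y j b| := by
      rw [lor, Fintype.sum_sum_type, add_mul]
      refine (abs_sub _ _).trans (add_le_add ?_ ?_)
      · rw [Finset.sum_mul]
        refine (Finset.abs_sum_le_sum_abs _ _).trans (Finset.sum_le_sum fun a _ => ?_)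
        rw [abs_mul]
        exact mul_le_mul_of_nonneg_left (abs_mulVec_le hk _ _) (abs_nonneg _)
      · rw [abs_mul]
        simpa using mul_le_mul_of_nonneg_left (abs_mulVec_le hk _ _) (abs_nonneg _)
    have h0 : ∀ j i, 0 ≤ (∑ a, |e i a|) * ∑ b, |y j b| := fun j i =>
      mul_nonneg (Finset.sum_nonneg fun _ _ => abs_nonneg _)
        (Finset.sum_nonneg fun _ _ => abs_nonneg _)
    refine h1.trans ?_
    refine (Finset.single_le_sum (f := fun i => (∑ a, |e i a|) * ∑ b, |y j b|)
      (fun i _ => h0 j i) (Finset.mem_univ i)).trans ?_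
    exact Finset.single_le_sum (f := fun j => ∑ i, (∑ a, |e i a|) * ∑ b, |y j b|)
      (fun j _ => Finset.sum_nonneg fun i _ => h0 j i) (Finset.mem_univ j)
  exact ⟨_, fun k hk => Matrix.det_le (abv := AbsoluteValue.abs) fun j i => hentry k hk j i⟩

/-- The values of `φ_{ξ,s}` on `K` are bounded as soon as the orbit `ρ(K) v` is bounded under a
separating set of linear functionals `ψ`. -/
theorem exists_seminorm_coAct_le {n : ℕ} {V I : Type} [AddCommGroup V] [Module ℝ V]
    [FiniteDimensional ℝ V] (ρ : Representation ℝ (SOp n) V) (e : Fin n → Mink n) (v : V)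
    (ψ : I → Module.Dual ℝ V) (hψ : ∀ x, (∀ i, ψ i x = 0) → x = 0)
    (hv : ∀ i, ∃ B, ∀ k ∈ stabO n, |ψ i (ρ k v)| ≤ B) (N : Seminorm ℝ (FormVal n V)) :
    ∃ B, ∀ k ∈ stabO n, N (coAct ρ k⁻¹ (initVal e v)) ≤ B := by
  let F : (Fin n → LieG n) × I → Module.Dual ℝ (FormVal n V) := fun p =>
    { toFun := fun η => ψ p.2 (η p.1)
      map_add' := fun η θ => by simp
      map_smul' := fun c η => by simp }
  obtain ⟨B, hB⟩ := exists_seminorm_le F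
    (fun η hη => AlternatingMap.ext fun X => hψ _ fun i => hη (X, i))
    (fun k : stabO n => coAct ρ k.1⁻¹ (initVal e v)) (fun p => by
      obtain ⟨B, hB⟩ := exists_abs_det_lor_le e fun j => (p.1 j).1 *ᵥ basePt n
      obtain ⟨C, hC⟩ := hv p.2
      refine ⟨B * C, fun k => ?_⟩
      change |ψ p.2 (coAct ρ k.1⁻¹ (initVal e v) p.1)| ≤ _
      rw [coAct_initVal_apply _ _ _ k.2, map_smul, smul_eq_mul, abs_mul]
      exact mul_le_mul (hB k.1 k.2) (hC _ (inv_mem k.2)) (abs_nonneg _)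
        ((abs_nonneg _).trans (hB k.1 k.2))) N
  exact ⟨B, fun k hk => hB ⟨k, hk⟩⟩

/-- The entries of `Ad(k) X` are bounded over `k ∈ K`. -/
theorem abs_adRep_apply_le {n : ℕ} {k : SOp n} (hk : k ∈ stabO n) (X : LieG n) (a b : Idx n) :
    |(adRep n k X).1 a b| ≤ ∑ d, ∑ c, |X.1 c d| := by
  have hentry : ∀ k ∈ stabO n, ∀ a b, |mat k a b| ≤ 1 := fun k hk a b =>
    (abs_mat_le k a b).trans (coshDisp_of_mem_stabO hk).le
  change |∑ d, (∑ c, mat k a c * X.1 c d) * mat k⁻¹ d b| ≤ _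
  refine (Finset.abs_sum_le_sum_abs _ _).trans (Finset.sum_le_sum fun d _ => ?_)
  rw [abs_mul]
  refine (mul_le_of_le_one_right (abs_nonneg _) (hentry _ (inv_mem hk) _ _)).trans ?_
  refine (Finset.abs_sum_le_sum_abs _ _).trans (Finset.sum_le_sum fun c _ => ?_)
  rw [abs_mul]
  exact mul_le_of_le_one_left (abs_nonneg _) (hentry _ hk _ _)

/-! ### Comparison with the Poincaré series -/

theorem exp_hypDist_orbit {n : ℕ} (s : ℝ) (g : SOp n) :
    Real.exp (-(s / 2) * hypDist (basePt n) (mat g *ᵥ basePt n)) =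
      Real.exp (Real.arcosh (coshDisp g)) ^ (-(s / 2)) := by
  rw [hypDist, ← coshDisp_eq, ← Real.exp_mul, mul_comm]

theorem exp_arcosh_le {x : ℝ} (hx : 1 ≤ x) : Real.exp (Real.arcosh x) ≤ 2 * x := by
  rw [Real.exp_arcosh hx]
  have h : √(x ^ 2 - 1) ≤ x := by
    rw [Real.sqrt_le_left (by linarith)]; linarith
  linarith

/-- A Poincaré series with nonpositive exponent only converges for a finite group. -/
theorem finite_of_poincareConverges {n : ℕ} {Γ : Subgroup (SOp n)} {s : ℝ} (hs : s ≤ 0)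
    (hP : PoincareConverges Γ (s / 2) (basePt n)) : Finite Γ := by
  have h := hP.tendsto_cofinite_zero.eventually_lt_const one_pos
  rw [Filter.eventually_cofinite] at h
  refine Set.finite_univ_iff.1 (h.subset fun γ _ => ?_)
  rw [Set.mem_ofPred_eq, not_lt, exp_hypDist_orbit]
  exact Real.one_le_rpow (Real.one_le_exp (Real.arcosh_nonneg (one_le_coshDisp _))) (by linarith)

/-- Absolute convergence of the Eisenstein series for any finite-dimensional representation in which
the orbit `ρ(K) v` is bounded. -/
theorem absConv_eisTerm {n : ℕ} (hn : 1 ≤ n) {Γ : Subgroup (SOp n)} [DiscreteTopology Γ]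
    (hΓ : TorsionFree Γ) {ξ : Bdry n} (hξ : IsFullRankParabolicPt Γ ξ)
    {e : Fin n → Mink n} (he : IsFrame ξ e) {s : ℝ}
    (hP : PoincareConverges Γ (s / 2) (basePt n))
    {V I : Type} [AddCommGroup V] [Module ℝ V]
    [FiniteDimensional ℝ V] (ρ : Representation ℝ (SOp n) V) (v : V)
    (ψ : I → Module.Dual ℝ V) (hψ : ∀ x, (∀ i, ψ i x = 0) → x = 0)
    (hv : ∀ i, ∃ B, ∀ k ∈ stabO n, |ψ i (ρ k v)| ≤ B)
    (h : LeftInv Γ ξ (phi ρ ξ e v s)) (g : SOp n) :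
    AbsConv (eisTerm Γ ξ (phi ρ ξ e v s) h g) := by
  intro N
  rcases le_or_gt s 0 with hs | hs
  · have := finite_of_poincareConverges hs hP
    exact Summable.of_finite
  obtain ⟨C, hC, hrep⟩ := exists_rep_coshDisp_le hn hΓ hξ he g
  obtain ⟨B, hB⟩ := exists_seminorm_coAct_le ρ e v ψ hψ hv N
  have hrep' : ∀ c : CosetSp Γ ξ, ∃ γ : Γ, Quotient.mk _ γ = c ∧
      coshDisp γ.1 ≤ C * -lor (mat (γ.1 * g) *ᵥ basePt n) ξ.vec := by
    intro c
    obtain ⟨γ, rfl⟩ := Quotient.exists_rep c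
    obtain ⟨δ, hδ, hle⟩ := hrep γ.1 γ.2
    refine ⟨⟨δ, hδ.1⟩ * γ, Quotient.sound ?_, ?_⟩
    · refine QuotientGroup.rightRel_apply.2 (Subgroup.mem_subgroupOf.2 ?_)
      have h1 : γ * ((⟨δ, hδ.1⟩ : Γ) * γ)⁻¹ = (⟨δ, hδ.1⟩ : Γ)⁻¹ := by group
      rw [h1]
      exact inv_mem hδ
    · have h1 := fix_vec_of_mem_parab hn hΓ hξ he hδ
      change coshDisp (δ * γ.1) ≤ C * -lor (mat (δ * γ.1 * g) *ᵥ basePt n) ξ.vec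
      rwa [mul_assoc δ, mat_mul_mulVec δ, lor_mat_vec_of_fix h1]
  choose r hr hrle using hrep'
  -- distinct cosets have distinct representatives, so the series is dominated by a subseries of the
  -- Poincaré series
  have hinj : Function.Injective r := fun c d hcd => by rw [← hr c, ← hr d, hcd]
  refine Summable.of_nonneg_of_le (fun c => apply_nonneg N _) (fun c => ?_)
    ((hP.comp_injective hinj).mul_left ((2 * C) ^ (s / 2) * B))
  have hval : eisTerm Γ ξ (phi ρ ξ e v s) h g c = phi ρ ξ e v s ((r c).1 * g) := by
    conv_lhs => rw [← hr c]
    rfl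
  have ht := iwT_pos ξ ((r c).1 * g)
  have hq := neg_lor_vec_pos ξ (orbit_mem_hyp ((r c).1 * g))
  have hB0 : 0 ≤ B := (apply_nonneg N _).trans (hB 1 (one_mem _))
  rw [hval, phi, map_smul_eq_mul, Real.norm_of_nonneg (Real.rpow_nonneg ht.le s),
    Function.comp_apply, exp_hypDist_orbit, mul_right_comm]
  refine mul_le_mul ?_ (hB _ (iwK_mem ξ _)) (apply_nonneg N _) (by positivity)
  have h1 : iwT ξ ((r c).1 * g) ^ s =
      (-lor (mat ((r c).1 * g) *ᵥ basePt n) ξ.vec)⁻¹ ^ (s / 2) := by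
    rw [← iwT_sq, ← Real.rpow_natCast, ← Real.rpow_mul ht.le]
    congr 1
    push_cast
    ring
  have hE := Real.exp_pos (Real.arcosh (coshDisp (r c).1))
  rw [h1, Real.rpow_neg hE.le, ← Real.inv_rpow hE.le, ← Real.mul_rpow (by positivity)
    (by positivity)]
  refine Real.rpow_le_rpow (by positivity) ?_ (by linarith)
  rw [← div_eq_mul_inv, inv_le_iff_one_le_mul₀ hq, div_mul_eq_mul_div, le_div_iff₀ hE, one_mul]
  refine (exp_arcosh_le (one_le_coshDisp _)).trans ?_
  linarith [hrle c]

end HypEisenstein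

end

open HypEisenstein in
/-- Absolute convergence of the Eisenstein series of a full rank cusp, for `V = ℝ` (trivial
representation) and for `V = 𝔤` (adjoint representation, `v ∈ 𝔤_{-2}` with `φ_{ξ,s}` left
`Γ_ξ`-invariant, so that the series makes sense). -/
theorem proposition4p1 (n : ℕ) (hn : 1 ≤ n) (Γ : Subgroup (SOp n)) (hΓ : DiscreteTopology Γ)
    (hΓ' : TorsionFree Γ) (ξ : Bdry n) (hξ : IsFullRankParabolicPt Γ ξ)
    (e : Fin n → Mink n) (he : IsFrame ξ e) (s : ℝ)
    (hP : PoincareConverges Γ (s / 2) (basePt n)) :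
    (∃ h : LeftInv Γ ξ (phi (Representation.trivial ℝ (SOp n) ℝ) ξ e 1 s),
      ∀ g : SOp n, AbsConv (eisTerm Γ ξ (phi (Representation.trivial ℝ (SOp n) ℝ) ξ e 1 s) h g)) ∧
    (∀ v ∈ rootSp ξ (-2), ∀ h : LeftInv Γ ξ (phi (adRep n) ξ e v s),
      ∀ g : SOp n, AbsConv (eisTerm Γ ξ (phi (adRep n) ξ e v s) h g)) := by
  refine ⟨⟨fun γ hγ g => phi_trivial_mul_left he s (fix_vec_of_mem_parab hn hΓ' hξ he hγ) g,
    fun g => ?_⟩, fun v _ h g => ?_⟩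
  · exact absConv_eisTerm hn hΓ' hξ he hP _ _ (fun _ : Unit => LinearMap.id)
      (fun x hx => hx ()) (fun _ => ⟨1, fun k _ => by simp⟩) _ g
  · exact absConv_eisTerm hn hΓ' hξ he hP _ _
      (fun p : Idx n × Idx n =>
        { toFun := fun X : LieG n => X.1 p.1 p.2
          map_add' := fun _ _ => rfl
          map_smul' := fun _ _ => rfl })
      (fun x hx => Subtype.ext (Matrix.ext fun a b => hx (a, b))) (fun p =>
        ⟨_, fun k hk => abs_adRep_apply_le hk v p.1 p.2⟩) h g
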